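/- **Theorem (bounded FO$(<,+1)$ translates into Q2MLO$(+1)$).** Let $\sigma$ be a set of monadic predicate symbols. Formulas are interpreted over the real line $(\mathbb{R},<,+1)$ with an arbitrary signal, i.e. an arbitrary set $V(P)\subseteq\mathbb{R}$ for each $P\in\sigma$. *FO$(<,+1)$* is first-order logic with equality over the predicates in $\sigma$, the binary relation $<$ and the function $x\mapsto x+1$ (so the relation $y=x+1$ is available). A formula $\psi(z)$ with one free variable $z$ is *bounded* if for some $N\in\mathbb{N}$ all its quantifiers are relativised to the interval $(z-N,z+N)$, i.e. are of the form $\exists y\,(z<y+N\wedge y<z+N\wedge\chi)$ or $\forall y\,(z<y+N\wedge y<z+N\rightarrow\chi)$. *Q2MLO$(+1)$* is the smallest set of formulas that contains $P(x)$, $x<y$, $x=y$, is closed under Boolean connectives and (unrestricted) first-order quantification over $\mathbb{R}$, and * with every formula $\varphi(y,z)$ whose free variables are among $y,z$, contains the metric quantifications $\exists_{z}^{z+1}y.\,\varphi(y,z)$ ("$\varphi(y,z)$ for some $y\in(z,z+1)$") and $\exists_{z-1}^{z}y.\,\varphi(y,z)$ ("$\varphi(y,z)$ for some $y\in(z-1,z)$");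 * with every formula $\varphi(w)$ whose only free variable is $w$, contains $\exists w\,(w=z+1\wedge\varphi(w))$ and $\exists w\,(z=w+1\wedge\varphi(w))$. Then for every bounded FO$(<,+1)$ formula $\psi(z)$ there is an equivalent Q2MLO$(+1)$ formula $\psi'(z)$: for every signal $V$ and every $z\in\mathbb{R}$, $\psi(z)$ holds at $z$ in $V$ if and only if $\psi'(z)$ does. -/

import Mathlib

universe u

namespace MetricLogic

/-! ### The logic FO(<,+1): monadic first-order logic of order and metric -/

/-- Function symbols of FO(<,+1): the unary function `+1`. -/
inductive FOFun : ℕ → Type u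
  | succ : FOFun 1

/-- Relation symbols of FO(<,+1): the monadic predicates `P` in `σ`, and the order `<`
(equality is built into first-order logic). -/
inductive FORel (σ : Type u) : ℕ → Type u
  | pred (P : σ) : FORel σ 1
  | lt : FORel σ 2

/-- The first-order language FO(<,+1) over the set `σ` of monadic predicates. The relation
`y = x + 1` is expressed by equality of terms. -/
def foLang (σ : Type u) : FirstOrder.Language.{u, u} := ⟨FOFun, FORel σ⟩

/-- A signal `V` (one arbitrary set of reals for each monadic predicate) makes the real line a
structure for FO(<,+1). -/
@[reducible] def realLine {σ : Type u} (V : σ → Set ℝ) : (foLang σ).Structure ℝ where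
  funMap := fun {_} f =>
    match f with
    | FOFun.succ => fun x => x 0 + 1
  RelMap := fun {_} r =>
    match r with
    | FORel.pred P => fun x => x 0 ∈ V P
    | FORel.lt => fun x => x 0 < x 1

/-- The formula `ψ(z)`, whose only free variable `z` is named by the point of `Unit`, holds at
time `z` of the signal `V`. -/
def FOHolds {σ : Type u} (V : σ → Set ℝ) (ψ : (foLang σ).Formula Unit) (z : ℝ) : Prop :=
  letI : (foLang σ).Structure ℝ := realLine V
  ψ.Realize (fun _ => z)

/-- The term `t + k`, for `k : ℕ`. -/
def addNat {σ α : Type*} (t : (foLang σ).Term α) : ℕ → (foLang σ).Term α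
  | 0 => t
  | k + 1 => FirstOrder.Language.Term.func (L := foLang σ) (l := 1) FOFun.succ (fun _ => addNat t k)

/-- The atomic formula `s < t`. -/
def ltFormula {σ : Type*} {n : ℕ} (s t : (foLang σ).Term (Unit ⊕ Fin n)) :
    (foLang σ).BoundedFormula Unit n :=
  FirstOrder.Language.BoundedFormula.rel (L := foLang σ) (l := 2) FORel.lt ![s, t]

/-- The guard `z < y + N ∧ y < z + N`, that is `y ∈ (z - N, z + N)`, where `z` is the free
variable and `y` is the innermost quantified variable. -/
def window (σ : Type*) (N n : ℕ) : (foLang σ).BoundedFormula Unit (n + 1) :=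
  let z : (foLang σ).Term (Unit ⊕ Fin (n + 1)) := FirstOrder.Language.Term.var (Sum.inl ())
  let y : (foLang σ).Term (Unit ⊕ Fin (n + 1)) := FirstOrder.Language.Term.var (Sum.inr (Fin.last n))
  ltFormula z (addNat y N) ⊓ ltFormula y (addNat z N)

/-- A formula with free variable `z` is `N`-bounded when each of its quantifiers is relativised
to the interval `(z - N, z + N)`. (Mathlib's type `BoundedFormula` has nothing to do with this:
its `n` counts the variables that are free because their quantifiers have been removed.) -/
inductive IsNBounded {σ : Type u} (N : ℕ) :
    ∀ {n : ℕ}, (foLang σ).BoundedFormula Unit n → Prop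
  | falsum {n : ℕ} : IsNBounded N (n := n) FirstOrder.Language.BoundedFormula.falsum
  | equal {n : ℕ} (s t : (foLang σ).Term (Unit ⊕ Fin n)) :
      IsNBounded N (FirstOrder.Language.BoundedFormula.equal s t)
  | rel {n l : ℕ} (R : (foLang σ).Relations l) (ts : Fin l → (foLang σ).Term (Unit ⊕ Fin n)) :
      IsNBounded N (FirstOrder.Language.BoundedFormula.rel R ts)
  | imp {n : ℕ} {φ χ : (foLang σ).BoundedFormula Unit n} :
      IsNBounded N φ → IsNBounded N χ → IsNBounded N (φ.imp χ)
  | all {n : ℕ} {φ : (foLang σ).BoundedFormula Unit (n + 1)} :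
      IsNBounded N φ → IsNBounded N ((window σ N n).imp φ).all
  | ex {n : ℕ} {φ : (foLang σ).BoundedFormula Unit (n + 1)} :
      IsNBounded N φ → IsNBounded N (window σ N n ⊓ φ).ex

/-- A formula `ψ(z)` of FO(<,+1) is bounded when it is `N`-bounded for some natural number `N`. -/
def IsBounded {σ : Type u} (ψ : (foLang σ).Formula Unit) : Prop :=
  ∃ N : ℕ, IsNBounded N ψ

/-! ### The logic Q2MLO(+1) -/

/-- Formulas of Q2MLO(+1) with free variables among `x₀, …, xₙ₋₁`: first-order monadic logic of
order, the metric quantifiers, which apply only to formulas with two free variables, and the `+1`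
relation, which occurs only as the guard of a quantifier over a formula with one free variable
(an unrestricted `+1` relation would give back all of FO(<,+1)). -/
inductive Q2MLO (σ : Type u) : ℕ → Type u
  /-- `P(xᵢ)` -/
  | pred {n : ℕ} (P : σ) (i : Fin n) : Q2MLO σ n
  /-- `xᵢ < xⱼ` -/
  | lt {n : ℕ} (i j : Fin n) : Q2MLO σ n
  /-- `xᵢ = xⱼ` -/
  | eq {n : ℕ} (i j : Fin n) : Q2MLO σ n
  /-- negation -/
  | neg {n : ℕ} (φ : Q2MLO σ n) : Q2MLO σ n
  /-- conjunction -/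
  | conj {n : ℕ} (φ χ : Q2MLO σ n) : Q2MLO σ n
  /-- the first-order quantifier `∃ xₙ. φ(x₀, …, xₙ)` -/
  | ex {n : ℕ} (φ : Q2MLO σ (n + 1)) : Q2MLO σ n
  /-- the metric quantifier `∃ y ∈ (z, z + 1). φ(z, y)`, with `z = xᵢ` -/
  | exNext {n : ℕ} (i : Fin n) (φ : Q2MLO σ 2) : Q2MLO σ n
  /-- the reverse metric quantifier `∃ y ∈ (z - 1, z). φ(z, y)`, with `z = xᵢ` -/
  | exPrev {n : ℕ} (i : Fin n) (φ : Q2MLO σ 2) : Q2MLO σ n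
  /-- punctuality: `∃ w. w = z + 1 ∧ φ(w)`, with `z = xᵢ` -/
  | atNext {n : ℕ} (i : Fin n) (φ : Q2MLO σ 1) : Q2MLO σ n
  /-- reverse punctuality: `∃ w. z = w + 1 ∧ φ(w)`, with `z = xᵢ` -/
  | atPrev {n : ℕ} (i : Fin n) (φ : Q2MLO σ 1) : Q2MLO σ n

/-- Semantics of Q2MLO(+1) over the real line with the signal `V`, under the assignment `v`. -/
def Q2MLO.Realize {σ : Type u} (V : σ → Set ℝ) : ∀ {n : ℕ}, Q2MLO σ n → (Fin n → ℝ) → Prop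
  | _, .pred P i, v => v i ∈ V P
  | _, .lt i j, v => v i < v j
  | _, .eq i j, v => v i = v j
  | _, .neg φ, v => ¬ φ.Realize V v
  | _, .conj φ χ, v => φ.Realize V v ∧ χ.Realize V v
  | _, .ex φ, v => ∃ y : ℝ, φ.Realize V (Fin.snoc v y)
  | _, .exNext i φ, v => ∃ y : ℝ, (v i < y ∧ y < v i + 1) ∧ φ.Realize V ![v i, y]
  | _, .exPrev i φ, v => ∃ y : ℝ, (v i - 1 < y ∧ y < v i) ∧ φ.Realize V ![v i, y]
  | _, .atNext i φ, v => ∃ w : ℝ, w = v i + 1 ∧ φ.Realize V ![w]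
  | _, .atPrev i φ, v => ∃ w : ℝ, v i = w + 1 ∧ φ.Realize V ![w]

/-- The Q2MLO(+1) formula `φ(z)` holds at time `z` of the signal `V`. -/
def Q2MLO.Holds {σ : Type u} (V : σ → Set ℝ) (φ : Q2MLO σ 1) (z : ℝ) : Prop :=
  φ.Realize V ![z]

end MetricLogic

/-!
A formula `ψ(z)` that is bounded speaks about a window of width `2N` around `z`. Each point of the
window is `x + k` for some `x ∈ [z, z + 1)` and one of finitely many integers `k`, so that `ψ(z)`
amounts to a formula about the points of `[z, z + 1)` in which the function `+1` no longer occurs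
and the predicates are `P(x + k)`. These are unary, hence expressible by punctuality. What remains
is to express in Q2MLO(+1) the first-order properties, in the language of order with definable unary
predicates, of the interval from `z` to `z + 1`.

The bridge is the notion of a *chain*: there are points `a < x₁ < ⋯ < xₙ < b` with prescribed unary
properties at the points and throughout the gaps. A relation between `a < b` is *decomposable*
(`Decomp`) if it is a finite union of chain conditions with conditions on the endpoints.
Decomposable relations are closed under conjunction, under the chop operation `∃ x ∈ (a, b), M(a, x)
∧ N(x, b)`, and, as in Rabinovich's proof of Kamp's theorem, under complement (`Decomp.not`). For
the complement, a chain is cut at the points where its first and last gaps cease to be satisfied,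
which exist by completeness of the real line; this reduces to chains with unconstrained outer gaps,
and there an earlier start is always better (`chain_exchange`). Closure under these operations
allows the elimination of quantifiers over `[z, z + 1)`: a bounded formula is a Boolean combination
of decomposable relations between consecutive points of a subdivision of `[z, z + 1]`
(`IsNBounded.piecewise`), and so expresses a decomposable relation between `z` and `z + 1`.

Since the metric quantifiers do not permit `z` and `z + 1` to be mentioned together, it has to be
shown finally that a chain between `a` and `b` is determined by what can be seen from `a` and from
`b` separately: it is a Boolean combination of relations `∃ y ∈ (a, b), M(a, y)` and `∃ y ∈ (a, b),
M(y, b)` (`twoSided_chain`). The same cuts serve here: the outer parts of the chain are seen from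
the ends, and the middle part is shorter. When `b = a + 1`, relations of these two forms are metric
quantifications at `a` and at `a + 1`.
-/

namespace MetricLogic

variable {σ : Type u}

/-! ### Definability in Q2MLO(+1) -/

/-- Renaming of the free variables of a Q2MLO(+1) formula. The scopes of metric quantifiers and of
punctuality operators are closed under their own variables, so they are left unchanged. -/
def Q2MLO.rename : ∀ {n m : ℕ}, (Fin n → Fin m) → Q2MLO σ n → Q2MLO σ m
  | _, _, f, .pred P i => .pred P (f i)
  | _, _, f, .lt i j => .lt (f i) (f j)
  | _, _, f, .eq i j => .eq (f i) (f j)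
  | _, _, f, .neg φ => .neg (φ.rename f)
  | _, _, f, .conj φ χ => .conj (φ.rename f) (χ.rename f)
  | _, m, f, .ex φ => .ex (φ.rename (Fin.snoc (fun i => (f i).castSucc) (Fin.last m)))
  | _, _, f, .exNext i φ => .exNext (f i) φ
  | _, _, f, .exPrev i φ => .exPrev (f i) φ
  | _, _, f, .atNext i φ => .atNext (f i) φ
  | _, _, f, .atPrev i φ => .atPrev (f i) φ

theorem Q2MLO.realize_rename (V : σ → Set ℝ) {n : ℕ} (φ : Q2MLO σ n) :
    ∀ {m : ℕ} (f : Fin n → Fin m) (v : Fin m → ℝ),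
      (φ.rename f).Realize V v ↔ φ.Realize V (v ∘ f) := by
  induction φ with
  | neg φ ih => intro m f v; simp only [rename, Realize, ih]
  | conj φ χ ih₁ ih₂ => intro m f v; simp only [rename, Realize, ih₁, ih₂]
  | ex φ ih =>
    intro m f v
    simp only [rename, Realize, ih]
    refine exists_congr fun y => ?_
    have : (Fin.snoc v y : Fin (m + 1) → ℝ) ∘
        (Fin.snoc (fun i => (f i).castSucc) (Fin.last m) : Fin _ → Fin (m + 1)) =
        (Fin.snoc (v ∘ f) y : Fin _ → ℝ) := by
      funext i
      refine Fin.lastCases ?_ (fun i => ?_) i <;> simp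
    rw [← this]
  | _ => intro m f v; simp only [rename, Realize, Function.comp]

/-- A family of sets of reals, one for each signal, is definable by a Q2MLO(+1) formula. -/
def UDef (p : (σ → Set ℝ) → ℝ → Prop) : Prop :=
  ∃ φ : Q2MLO σ 1, ∀ V x, φ.Holds V x ↔ p V x

/-- A family of binary relations on the reals is definable by a Q2MLO(+1) formula. -/
def BDef (M : (σ → Set ℝ) → ℝ → ℝ → Prop) : Prop :=
  ∃ φ : Q2MLO σ 2, ∀ V a b, φ.Realize V ![a, b] ↔ M V a b

theorem UDef.holds (φ : Q2MLO σ 1) : UDef (fun V x => φ.Holds V x) := ⟨φ, fun _ _ => Iff.rfl⟩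

theorem UDef.congr {p q : (σ → Set ℝ) → ℝ → Prop} (hp : UDef p) (h : ∀ V x, p V x ↔ q V x) :
    UDef q := by
  obtain ⟨φ, hφ⟩ := hp
  exact ⟨φ, fun V x => (hφ V x).trans (h V x)⟩

theorem UDef.not {p : (σ → Set ℝ) → ℝ → Prop} (hp : UDef p) : UDef (fun V x => ¬ p V x) := by
  obtain ⟨φ, hφ⟩ := hp
  exact ⟨.neg φ, fun V x => not_congr (hφ V x)⟩

theorem UDef.and {p q : (σ → Set ℝ) → ℝ → Prop} (hp : UDef p) (hq : UDef q) :
    UDef (fun V x => p V x ∧ q V x) := by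
  obtain ⟨φ, hφ⟩ := hp
  obtain ⟨χ, hχ⟩ := hq
  exact ⟨.conj φ χ, fun V x => and_congr (hφ V x) (hχ V x)⟩

theorem UDef.or {p q : (σ → Set ℝ) → ℝ → Prop} (hp : UDef p) (hq : UDef q) :
    UDef (fun V x => p V x ∨ q V x) :=
  (hp.not.and hq.not).not.congr fun _ _ => by tauto

theorem BDef.congr {M N : (σ → Set ℝ) → ℝ → ℝ → Prop} (hM : BDef M)
    (h : ∀ V a b, M V a b ↔ N V a b) : BDef N := by
  obtain ⟨φ, hφ⟩ := hM
  exact ⟨φ, fun V a b => (hφ V a b).trans (h V a b)⟩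

theorem BDef.not {M : (σ → Set ℝ) → ℝ → ℝ → Prop} (hM : BDef M) :
    BDef (fun V a b => ¬ M V a b) := by
  obtain ⟨φ, hφ⟩ := hM
  exact ⟨.neg φ, fun V a b => not_congr (hφ V a b)⟩

theorem BDef.and {M N : (σ → Set ℝ) → ℝ → ℝ → Prop} (hM : BDef M) (hN : BDef N) :
    BDef (fun V a b => M V a b ∧ N V a b) := by
  obtain ⟨φ, hφ⟩ := hM
  obtain ⟨χ, hχ⟩ := hN
  exact ⟨.conj φ χ, fun V a b => and_congr (hφ V a b) (hχ V a b)⟩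

theorem UDef.left {p : (σ → Set ℝ) → ℝ → Prop} (hp : UDef p) : BDef (fun V a _ => p V a) := by
  obtain ⟨φ, hφ⟩ := hp
  refine ⟨φ.rename ![0], fun V a b => ?_⟩
  simp only [Q2MLO.realize_rename, ← hφ, Q2MLO.Holds]
  congr! 1
  funext i; fin_cases i; rfl

theorem UDef.right {p : (σ → Set ℝ) → ℝ → Prop} (hp : UDef p) : BDef (fun V _ b => p V b) := by
  obtain ⟨φ, hφ⟩ := hp
  refine ⟨φ.rename ![1], fun V a b => ?_⟩
  simp only [Q2MLO.realize_rename, ← hφ, Q2MLO.Holds]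
  congr! 1
  funext i; fin_cases i; rfl

theorem BDef.swap {M : (σ → Set ℝ) → ℝ → ℝ → Prop} (hM : BDef M) :
    BDef (fun V a b => M V b a) := by
  obtain ⟨φ, hφ⟩ := hM
  refine ⟨φ.rename ![1, 0], fun V a b => ?_⟩
  simp only [Q2MLO.realize_rename, ← hφ]
  congr! 1
  funext i; fin_cases i <;> rfl

/-- Definable relations are closed under the chop operation. -/
theorem BDef.chop {M N : (σ → Set ℝ) → ℝ → ℝ → Prop} (hM : BDef M) (hN : BDef N) :
    BDef (fun V a b => ∃ x, a < x ∧ x < b ∧ M V a x ∧ N V x b) := by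
  obtain ⟨φ, hφ⟩ := hM
  obtain ⟨χ, hχ⟩ := hN
  refine ⟨.ex (.conj (.lt 0 2) (.conj (.lt 2 1)
    (.conj (φ.rename ![0, 2]) (χ.rename ![2, 1])))), fun V a b => ?_⟩
  simp only [Q2MLO.Realize, Q2MLO.realize_rename, ← hφ, ← hχ]
  refine exists_congr fun x => ?_
  have h : (Fin.snoc ![a, b] x : Fin 3 → ℝ) = ![a, b, x] := by
    funext i; fin_cases i <;> rfl
  have h₁ : ![a, b, x] ∘ ![0, 2] = ![a, x] := by funext i; fin_cases i <;> rfl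
  have h₂ : ![a, b, x] ∘ ![2, 1] = ![x, b] := by funext i; fin_cases i <;> rfl
  rw [h, h₁, h₂]
  rfl

theorem BDef.exists_gt {M : (σ → Set ℝ) → ℝ → ℝ → Prop} (hM : BDef M) :
    UDef (fun V a => ∃ y, a < y ∧ M V a y) := by
  obtain ⟨φ, hφ⟩ := hM
  refine ⟨.ex (.conj (.lt 0 1) φ), fun V a => ?_⟩
  simp only [Q2MLO.Holds, Q2MLO.Realize, ← hφ]
  refine exists_congr fun y => ?_
  have h : (Fin.snoc ![a] y : Fin 2 → ℝ) = ![a, y] := by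
    funext i; fin_cases i <;> rfl
  rw [h]
  rfl

theorem BDef.exists_lt {M : (σ → Set ℝ) → ℝ → ℝ → Prop} (hM : BDef M) :
    UDef (fun V b => ∃ y, y < b ∧ M V y b) := by
  obtain ⟨φ, hφ⟩ := hM.swap
  refine ⟨.ex (.conj (.lt 1 0) φ), fun V b => ?_⟩
  simp only [Q2MLO.Holds, Q2MLO.Realize, ← hφ]
  refine exists_congr fun y => ?_
  have h : (Fin.snoc ![b] y : Fin 2 → ℝ) = ![b, y] := by
    funext i; fin_cases i <;> rfl
  rw [h]
  rfl

theorem BDef.exists_next {M : (σ → Set ℝ) → ℝ → ℝ → Prop} (hM : BDef M) :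
    UDef (fun V z => ∃ y, z < y ∧ y < z + 1 ∧ M V z y) := by
  obtain ⟨φ, hφ⟩ := hM
  refine ⟨.exNext 0 φ, fun V z => ?_⟩
  simp only [Q2MLO.Holds, Q2MLO.Realize, Matrix.cons_val_zero, hφ, and_assoc]

theorem BDef.exists_prev {M : (σ → Set ℝ) → ℝ → ℝ → Prop} (hM : BDef M) :
    UDef (fun V w => ∃ y, w - 1 < y ∧ y < w ∧ M V y w) := by
  obtain ⟨φ, hφ⟩ := hM.swap
  refine ⟨.exPrev 0 φ, fun V z => ?_⟩
  simp only [Q2MLO.Holds, Q2MLO.Realize, Matrix.cons_val_zero, hφ, and_assoc]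

theorem UDef.next {p : (σ → Set ℝ) → ℝ → Prop} (hp : UDef p) : UDef (fun V z => p V (z + 1)) := by
  obtain ⟨φ, hφ⟩ := hp
  refine ⟨.atNext 0 φ, fun V z => ?_⟩
  simp only [Q2MLO.Holds, Q2MLO.Realize, Matrix.cons_val_zero, ← hφ, exists_eq_left]

theorem UDef.prev {p : (σ → Set ℝ) → ℝ → Prop} (hp : UDef p) : UDef (fun V z => p V (z - 1)) := by
  obtain ⟨φ, hφ⟩ := hp
  refine ⟨.atPrev 0 φ, fun V z => ?_⟩
  simp only [Q2MLO.Holds, Q2MLO.Realize, Matrix.cons_val_zero, ← hφ, ← sub_eq_iff_eq_add,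
    exists_eq_left']

theorem UDef.shift {p : (σ → Set ℝ) → ℝ → Prop} (hp : UDef p) (k : ℤ) :
    UDef (fun V z => p V (z + k)) := by
  induction k with
  | zero => simpa using hp
  | succ k ih => exact ih.next.congr fun V z => by push_cast; rw [add_right_comm, add_assoc]
  | pred k ih =>
    exact ih.prev.congr fun V z => by
      push_cast; rw [sub_add_eq_add_sub, add_sub_assoc]

theorem udef_pred (P : σ) : UDef (fun V x => x ∈ V P) := ⟨.pred P 0, fun _ _ => Iff.rfl⟩

/-- The formula that holds everywhere. -/
def verum (σ : Type u) : Q2MLO σ 1 := .eq 0 0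

@[simp] theorem holds_verum (V : σ → Set ℝ) (x : ℝ) : (verum σ).Holds V x := rfl

@[simp] theorem holds_neg (V : σ → Set ℝ) (φ : Q2MLO σ 1) (x : ℝ) :
    (Q2MLO.neg φ).Holds V x ↔ ¬ φ.Holds V x := Iff.rfl

@[simp] theorem holds_conj (V : σ → Set ℝ) (φ χ : Q2MLO σ 1) (x : ℝ) :
    (Q2MLO.conj φ χ).Holds V x ↔ φ.Holds V x ∧ χ.Holds V x := Iff.rfl

/-! ### Chains -/

/-- The property `β` holds throughout the open interval `(a, b)`. -/
def full (V : σ → Set ℝ) (β : Q2MLO σ 1) (a b : ℝ) : Prop :=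
  ∀ y, a < y → y < b → β.Holds V y

/-- The chain condition with first gap `β₀` and list `[(α₁, β₁), …, (αₙ, βₙ)]`: there are points
`a < x₁ < ⋯ < xₙ < b` such that `αᵢ` holds at `xᵢ`, and `βᵢ` holds throughout the gap between `xᵢ`
and `xᵢ₊₁`, where `x₀ = a` and `xₙ₊₁ = b`. -/
def chain (V : σ → Set ℝ) : Q2MLO σ 1 → List (Q2MLO σ 1 × Q2MLO σ 1) → ℝ → ℝ → Prop
  | β, [], a, b => full V β a b
  | β, p :: l, a, b =>
    ∃ x, a < x ∧ x < b ∧ full V β a x ∧ p.1.Holds V x ∧ chain V p.2 l x b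

/-- The label of the last gap of a chain. -/
def lastGap : Q2MLO σ 1 → List (Q2MLO σ 1 × Q2MLO σ 1) → Q2MLO σ 1
  | β, [] => β
  | _, p :: l => lastGap p.2 l

theorem full.mono {V : σ → Set ℝ} {β : Q2MLO σ 1} {a b a' b' : ℝ} (h : full V β a b)
    (ha : a ≤ a') (hb : b' ≤ b) : full V β a' b' :=
  fun y h₁ h₂ => h y (ha.trans_lt h₁) (h₂.trans_le hb)

theorem full.glue {V : σ → Set ℝ} {β : Q2MLO σ 1} {a x b : ℝ} (h₁ : full V β a x)
    (hx : β.Holds V x) (h₂ : full V β x b) : full V β a b := by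
  intro y hay hyb
  rcases lt_trichotomy y x with h | rfl | h
  exacts [h₁ y hay h, hx, h₂ y h hyb]

theorem full_verum (V : σ → Set ℝ) (a b : ℝ) : full V (verum σ) a b := fun _ _ _ => holds_verum _ _

theorem bdef_full (β : Q2MLO σ 1) : BDef (fun V a b => full V β a b) := by
  refine (((UDef.holds (verum σ)).left.chop (UDef.holds (.neg β)).left).not).congr fun V a b => ?_
  simp only [holds_verum, holds_neg, true_and, full]
  push Not
  rfl

theorem bdef_chain (l : List (Q2MLO σ 1 × Q2MLO σ 1)) :
    ∀ β, BDef (fun V a b => chain V β l a b) := by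
  induction l with
  | nil => exact bdef_full
  | cons p l ih =>
    intro β
    exact ((bdef_full β).chop ((UDef.holds p.1).left.and (ih p.2)))

theorem full.chain_congr_left {V : σ → Set ℝ} {β : Q2MLO σ 1} {a b : ℝ} (h : full V β a b)
    (l : List (Q2MLO σ 1 × Q2MLO σ 1)) : chain V β l a b ↔ chain V (verum σ) l a b := by
  cases l with
  | nil => exact iff_of_true h (full_verum _ _ _)
  | cons p l =>
    refine exists_congr fun x => and_congr_right fun _ => and_congr_right fun hx => ?_
    exact and_congr_left fun _ => iff_of_true (h.mono le_rfl hx.le) (full_verum _ _ _)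

/-- A chain whose first gap is unconstrained may be moved to a larger left neighbourhood. -/
theorem chain_verum_mono {V : σ → Set ℝ} {l : List (Q2MLO σ 1 × Q2MLO σ 1)} {a a' b : ℝ}
    (ha : a ≤ a') (h : chain V (verum σ) l a' b) : chain V (verum σ) l a b := by
  cases l with
  | nil => exact full_verum _ _ _
  | cons p l =>
    obtain ⟨x, h₁, h₂, -, h₃⟩ := h
    exact ⟨x, ha.trans_lt h₁, h₂, full_verum _ _ _, h₃⟩

theorem chain_append (V : σ → Set ℝ) (p : Q2MLO σ 1 × Q2MLO σ 1)
    (l₂ : List (Q2MLO σ 1 × Q2MLO σ 1)) (b : ℝ) (l₁ : List (Q2MLO σ 1 × Q2MLO σ 1)) :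
    ∀ (β : Q2MLO σ 1) (a : ℝ), chain V β (l₁ ++ p :: l₂) a b ↔
      ∃ x, a < x ∧ x < b ∧ chain V β l₁ a x ∧ p.1.Holds V x ∧ chain V p.2 l₂ x b := by
  induction l₁ with
  | nil => intro β a; rfl
  | cons q l₁ ih =>
    intro β a
    simp only [List.cons_append, chain, ih]
    constructor
    · rintro ⟨y, hay, hyb, hf, hq, x, hyx, hxb, hc, hp⟩
      exact ⟨x, hay.trans hyx, hxb, ⟨y, hay, hyx, hf, hq, hc⟩, hp⟩
    · rintro ⟨x, hax, hxb, ⟨y, hay, hyx, hf, hq, hc⟩, hp⟩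
      exact ⟨y, hay, hyx.trans hxb, hf, hq, x, hyx, hxb, hc, hp⟩

theorem lastGap_append (p : Q2MLO σ 1 × Q2MLO σ 1) (l₂ l₁ : List (Q2MLO σ 1 × Q2MLO σ 1)) :
    ∀ β, lastGap β (l₁ ++ p :: l₂) = lastGap p.2 l₂ := by
  induction l₁ with
  | nil => intro β; rfl
  | cons q l₁ ih => intro β; exact ih q.2

/-! ### Splitting a chain at a point -/

/-- A way for a chain to pass over a point `t`: the points of the chain to the left of `t`, what
holds at `t`, and the chain to the right of `t`. -/
structure Split (σ : Type u) where
  /-- the points and gaps to the left -/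
  before : List (Q2MLO σ 1 × Q2MLO σ 1)
  /-- what holds at the point of splitting -/
  mid : Q2MLO σ 1
  /-- the first gap to the right -/
  gap : Q2MLO σ 1
  /-- the points and gaps to the right -/
  after : List (Q2MLO σ 1 × Q2MLO σ 1)

/-- The ways in which a chain can pass over a point: the point lies in a gap, or is a point of the
chain. -/
def splits : Q2MLO σ 1 → List (Q2MLO σ 1 × Q2MLO σ 1) → List (Split σ)
  | β, [] => [⟨[], β, β, []⟩]
  | β, p :: l => ⟨[], β, β, p :: l⟩ :: ⟨[], p.1, p.2, l⟩ ::
      (splits p.2 l).map fun s => ⟨p :: s.before, s.mid, s.gap, s.after⟩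

/-- The conditions that a splitting at `t` of a chain with first gap `β` imposes. -/
def Split.Holds (V : σ → Set ℝ) (s : Split σ) (β : Q2MLO σ 1) (a t b : ℝ) : Prop :=
  chain V β s.before a t ∧ s.mid.Holds V t ∧ chain V s.gap s.after t b

theorem Split.Holds.chain {V : σ → Set ℝ} {t b : ℝ} (htb : t < b)
    {l : List (Q2MLO σ 1 × Q2MLO σ 1)} : ∀ {β : Q2MLO σ 1} {s : Split σ} {a : ℝ}, a < t →
      s ∈ splits β l → s.Holds V β a t b → chain V β l a b := by
  induction l with
  | nil =>
    intro β s a hat hs h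
    obtain rfl : s = _ := List.mem_singleton.1 hs
    exact full.glue h.1 h.2.1 h.2.2
  | cons p l ih =>
    intro β s a hat hs h
    simp only [splits, List.mem_cons, List.mem_map] at hs
    obtain rfl | rfl | ⟨s, hs, rfl⟩ := hs
    · obtain ⟨h₁, h₂, x, htx, hxb, hf, hx⟩ := h
      exact ⟨x, hat.trans htx, hxb, full.glue h₁ h₂ hf, hx⟩
    · exact ⟨t, hat, htb, h.1, h.2⟩
    · obtain ⟨⟨x, hax, hxt, hf, hx, hc⟩, h₂⟩ := h
      exact ⟨x, hax, hxt.trans htb, hf, hx, ih hxt hs ⟨hc, h₂⟩⟩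

theorem exists_split {V : σ → Set ℝ} {t b : ℝ} (htb : t < b)
    {l : List (Q2MLO σ 1 × Q2MLO σ 1)} : ∀ {β : Q2MLO σ 1} {a : ℝ}, a < t → chain V β l a b →
      ∃ s ∈ splits β l, s.Holds V β a t b := by
  induction l with
  | nil =>
    intro β a hat h
    exact ⟨_, List.mem_singleton.2 rfl, h.mono le_rfl htb.le, h t hat htb, h.mono hat.le le_rfl⟩
  | cons p l ih =>
    intro β a hat h
    obtain ⟨x, hax, hxb, hf, hx, hc⟩ := h
    rcases lt_trichotomy x t with hxt | rfl | htx
    · obtain ⟨s, hs, h₁, h₂⟩ := ih hxt hc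
      exact ⟨⟨p :: s.before, s.mid, s.gap, s.after⟩,
        .tail _ (.tail _ (List.mem_map.2 ⟨s, hs, rfl⟩)), ⟨x, hax, hxt, hf, hx, h₁⟩, h₂⟩
    · exact ⟨⟨[], p.1, p.2, l⟩, by simp [splits], hf, hx, hc⟩
    · exact ⟨⟨[], β, β, p :: l⟩, by simp [splits], hf.mono le_rfl htx.le, hf t hat htx,
        x, htx, hxb, hf.mono hat.le le_rfl, hx, hc⟩

theorem splits_before_length {l : List (Q2MLO σ 1 × Q2MLO σ 1)} : ∀ {β : Q2MLO σ 1}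
    {s : Split σ}, s ∈ splits β l → s.before.length ≤ l.length := by
  induction l with
  | nil => intro β s hs; obtain rfl : s = _ := List.mem_singleton.1 hs; simp
  | cons p l ih =>
    intro β s hs
    simp only [splits, List.mem_cons, List.mem_map] at hs
    obtain rfl | rfl | ⟨s, hs, rfl⟩ := hs
    · simp
    · simp
    · simpa using ih hs

theorem splits_after {l : List (Q2MLO σ 1 × Q2MLO σ 1)} : ∀ {β : Q2MLO σ 1} {s : Split σ},
    s ∈ splits β l → s = ⟨[], β, β, l⟩ ∨ s.after.length < l.length := by
  induction l with
  | nil => intro β s hs; exact .inl (List.mem_singleton.1 hs)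
  | cons p l ih =>
    intro β s hs
    simp only [splits, List.mem_cons, List.mem_map] at hs
    obtain rfl | rfl | ⟨s, hs, rfl⟩ := hs
    · exact .inl rfl
    · exact .inr (by simp)
    · refine .inr ?_
      rcases ih hs with rfl | h
      · simp
      · simp only [List.length_cons]; lia

theorem splits_lastGap {l : List (Q2MLO σ 1 × Q2MLO σ 1)} : ∀ {β : Q2MLO σ 1} {s : Split σ},
    s ∈ splits β l → lastGap s.gap s.after = lastGap β l := by
  induction l with
  | nil => intro β s hs; obtain rfl : s = _ := List.mem_singleton.1 hs; rfl
  | cons p l ih =>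
    intro β s hs
    simp only [splits, List.mem_cons, List.mem_map] at hs
    obtain rfl | rfl | ⟨s, hs, rfl⟩ := hs
    · rfl
    · rfl
    · have h := ih hs
      exact h

/-! ### Extents -/

/-- The point `s` is the extent of `β` to the right of `a`: it is the largest point such that `β`
holds throughout `(a, s)`. -/
def IsRightExtent (V : σ → Set ℝ) (β : Q2MLO σ 1) (a s : ℝ) : Prop :=
  full V β a s ∧ (β.Holds V s → ∀ y, s < y → ¬ full V β s y)

/-- The point `t` is the extent of `β` to the left of `b`: it is the smallest point such that `β`
holds throughout `(t, b)`. -/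
def IsLeftExtent (V : σ → Set ℝ) (β : Q2MLO σ 1) (t b : ℝ) : Prop :=
  full V β t b ∧ (β.Holds V t → ∀ y, y < t → ¬ full V β y t)

theorem udef_not_full_right (β : Q2MLO σ 1) :
    UDef (fun V s => ∀ y, s < y → ¬ full V β s y) :=
  (bdef_full β).exists_gt.not.congr fun V s => by push Not; rfl

theorem udef_not_full_left (β : Q2MLO σ 1) :
    UDef (fun V s => ∀ y, y < s → ¬ full V β y s) :=
  (bdef_full β).exists_lt.not.congr fun V s => by push Not; rfl

theorem udef_rightEnd (β : Q2MLO σ 1) :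
    UDef (fun V s => β.Holds V s → ∀ y, s < y → ¬ full V β s y) :=
  ((UDef.holds β).not.or (udef_not_full_right β)).congr fun V s => by tauto

theorem udef_leftEnd (β : Q2MLO σ 1) :
    UDef (fun V s => β.Holds V s → ∀ y, y < s → ¬ full V β y s) :=
  ((UDef.holds β).not.or (udef_not_full_left β)).congr fun V s => by tauto

theorem bdef_isRightExtent (β : Q2MLO σ 1) : BDef (fun V a s => IsRightExtent V β a s) :=
  (bdef_full β).and (udef_rightEnd β).right

theorem bdef_isLeftExtent (β : Q2MLO σ 1) : BDef (fun V t b => IsLeftExtent V β t b) :=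
  (bdef_full β).and (udef_leftEnd β).left

theorem IsRightExtent.unique {V : σ → Set ℝ} {β : Q2MLO σ 1} {a s s' : ℝ} (has : a < s)
    (has' : a < s') (h : IsRightExtent V β a s) (h' : IsRightExtent V β a s') : s = s' := by
  rcases lt_trichotomy s s' with hlt | rfl | hlt
  · exact (h.2 (h'.1 s has hlt) s' hlt (h'.1.mono has.le le_rfl)).elim
  · rfl
  · exact (h'.2 (h.1 s' has' hlt) s hlt (h.1.mono has'.le le_rfl)).elim

theorem IsLeftExtent.unique {V : σ → Set ℝ} {β : Q2MLO σ 1} {t t' b : ℝ} (htb : t < b)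
    (htb' : t' < b) (h : IsLeftExtent V β t b) (h' : IsLeftExtent V β t' b) : t = t' := by
  rcases lt_trichotomy t t' with hlt | rfl | hlt
  · exact (h'.2 (h.1 t' hlt htb') t hlt (h.1.mono le_rfl htb'.le)).elim
  · rfl
  · exact (h.2 (h'.1 t hlt htb) t' hlt (h'.1.mono le_rfl htb.le)).elim

/-- Completeness of the real line gives the extent to the right, unless `β` fails arbitrarily close
to `a`. -/
theorem exists_isRightExtent {V : σ → Set ℝ} {β : Q2MLO σ 1} {a b : ℝ} (h : ¬ full V β a b) :
    (∀ y, a < y → ¬ full V β a y) ∨ ∃ s, a < s ∧ s < b ∧ IsRightExtent V β a s := by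
  simp only [full, not_forall] at h
  obtain ⟨c, hac, hcb, hc⟩ := h
  set B : Set ℝ := {y | a < y ∧ ¬ β.Holds V y} with hB
  have hne : B.Nonempty := ⟨c, hac, hc⟩
  have hbdd : BddBelow B := ⟨a, fun y hy => hy.1.le⟩
  have hacc : ∀ y, sInf B < y → ∃ z ∈ B, sInf B ≤ z ∧ z < y := fun y hy => by
    obtain ⟨z, hz, hzy⟩ := (csInf_lt_iff hbdd hne).1 hy
    exact ⟨z, hz, csInf_le hbdd hz, hzy⟩
  rcases (le_csInf hne fun y hy => hy.1.le : a ≤ sInf B).eq_or_lt with heq | hlt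
  · left
    intro y hy hf
    obtain ⟨z, hz, -, hzy⟩ := hacc y (heq ▸ hy)
    exact hz.2 (hf z hz.1 hzy)
  · refine .inr ⟨sInf B, hlt, (csInf_le hbdd ⟨hac, hc⟩).trans_lt hcb, fun y hy hys => ?_,
      fun hs y hy hf => ?_⟩
    · by_contra hn
      exact hys.not_ge (csInf_le hbdd ⟨hy, hn⟩)
    · obtain ⟨z, hz, hsz, hzy⟩ := hacc y hy
      rcases hsz.eq_or_lt with h | h
      · exact hz.2 (h ▸ hs)
      · exact hz.2 (hf z h hzy)

theorem exists_isLeftExtent {V : σ → Set ℝ} {β : Q2MLO σ 1} {a b : ℝ} (h : ¬ full V β a b) :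
    (∀ y, y < b → ¬ full V β y b) ∨ ∃ t, a < t ∧ t < b ∧ IsLeftExtent V β t b := by
  simp only [full, not_forall] at h
  obtain ⟨c, hac, hcb, hc⟩ := h
  set B : Set ℝ := {y | y < b ∧ ¬ β.Holds V y} with hB
  have hne : B.Nonempty := ⟨c, hcb, hc⟩
  have hbdd : BddAbove B := ⟨b, fun y hy => hy.1.le⟩
  have hacc : ∀ y, y < sSup B → ∃ z ∈ B, z ≤ sSup B ∧ y < z := fun y hy => by
    obtain ⟨z, hz, hzy⟩ := (lt_csSup_iff hbdd hne).1 hy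
    exact ⟨z, hz, le_csSup hbdd hz, hzy⟩
  rcases (csSup_le hne fun y hy => hy.1.le : sSup B ≤ b).eq_or_lt with heq | hlt
  · left
    intro y hy hf
    obtain ⟨z, hz, -, hzy⟩ := hacc y (heq.symm ▸ hy)
    exact hz.2 (hf z hzy hz.1)
  · refine .inr ⟨sSup B, hac.trans_le (le_csSup hbdd ⟨hcb, hc⟩), hlt, fun y hys hy => ?_,
      fun hs y hy hf => ?_⟩
    · by_contra hn
      exact hys.not_ge (le_csSup hbdd ⟨hy, hn⟩)
    · obtain ⟨z, hz, hsz, hzy⟩ := hacc y hy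
      rcases hsz.eq_or_lt with h | h
      · exact hz.2 (h ▸ hs)
      · exact hz.2 (hf z hzy h)

/-- A chain with at least one point has its first point at or before the extent of its first
gap. -/
theorem exists_split_of_isRightExtent {V : σ → Set ℝ} {β : Q2MLO σ 1}
    {l : List (Q2MLO σ 1 × Q2MLO σ 1)} (hl : l ≠ []) {a s b : ℝ} (has : a < s) (hsb : s < b)
    (hs : IsRightExtent V β a s) (h : chain V β l a b) :
    ∃ r ∈ splits β l, r.after.length < l.length ∧ r.Holds V β a s b := by
  obtain ⟨r, hr, hh⟩ := exists_split hsb has h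
  rcases splits_after hr with rfl | hlt
  · obtain ⟨p, l, rfl⟩ := List.exists_cons_of_ne_nil hl
    obtain ⟨x, hsx, -, hf, -⟩ := hh.2.2
    exact (hs.2 hh.2.1 x hsx hf).elim
  · exact ⟨r, hr, hlt, hh⟩

/-- A chain with at least one point has its last point at or after the extent of its last gap. -/
theorem exists_split_of_isLeftExtent {V : σ → Set ℝ} {t b : ℝ} (htb : t < b)
    {l : List (Q2MLO σ 1 × Q2MLO σ 1)} : ∀ {β : Q2MLO σ 1} {a : ℝ}, l ≠ [] → a < t →
      IsLeftExtent V (lastGap β l) t b → chain V β l a b →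
      ∃ r ∈ splits β l, r.before.length < l.length ∧ r.Holds V β a t b := by
  induction l with
  | nil => intro β a hl; exact (hl rfl).elim
  | cons p l ih =>
    intro β a _ hat ht h
    obtain ⟨x, hax, hxb, hf, hx, hc⟩ := h
    rcases lt_trichotomy x t with hxt | rfl | htx
    · by_cases hl : l = []
      · subst hl
        exact (ht.2 (hc t hxt htb) x hxt (hc.mono le_rfl htb.le)).elim
      · obtain ⟨s, hs, hlt, h₁, h₂⟩ := ih hl hxt ht hc
        exact ⟨⟨p :: s.before, s.mid, s.gap, s.after⟩,
          .tail _ (.tail _ (List.mem_map.2 ⟨s, hs, rfl⟩)), by simpa using hlt,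
          ⟨x, hax, hxt, hf, hx, h₁⟩, h₂⟩
    · exact ⟨⟨[], p.1, p.2, l⟩, by simp [splits], by simp, hf, hx, hc⟩
    · exact ⟨⟨[], β, β, p :: l⟩, by simp [splits], by simp, hf.mono le_rfl htx.le, hf t hat htx,
        x, htx, hxb, hf.mono hat.le le_rfl, hx, hc⟩

/-! ### Decomposable relations -/

/-- A condition on the endpoints of an interval together with a chain inside the interval. -/
structure Item (σ : Type u) where
  /-- the condition on the left endpoint -/
  left : Q2MLO σ 1
  /-- the first gap -/
  gap : Q2MLO σ 1
  /-- the points of the chain and the gaps that follow them -/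
  points : List (Q2MLO σ 1 × Q2MLO σ 1)
  /-- the condition on the right endpoint -/
  right : Q2MLO σ 1

/-- The interval from `a` to `b` satisfies the conditions of an item. -/
def Item.Holds (V : σ → Set ℝ) (i : Item σ) (a b : ℝ) : Prop :=
  i.left.Holds V a ∧ chain V i.gap i.points a b ∧ i.right.Holds V b

/-- A family of binary relations is decomposable when, on pairs `a < b`, it is a finite union of
chain conditions with conditions on the endpoints. -/
def Decomp (M : (σ → Set ℝ) → ℝ → ℝ → Prop) : Prop :=
  ∃ L : List (Item σ), ∀ V a b, a < b → (M V a b ↔ ∃ i ∈ L, i.Holds V a b)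

namespace Decomp

variable {M N : (σ → Set ℝ) → ℝ → ℝ → Prop}

theorem congr (hM : Decomp M) (h : ∀ V a b, a < b → (M V a b ↔ N V a b)) : Decomp N := by
  obtain ⟨L, hL⟩ := hM
  exact ⟨L, fun V a b hab => (h V a b hab).symm.trans (hL V a b hab)⟩

theorem item (i : Item σ) : Decomp (fun V a b => i.Holds V a b) :=
  ⟨[i], fun V a b _ => by simp⟩

theorem chain (β : Q2MLO σ 1) (l : List (Q2MLO σ 1 × Q2MLO σ 1)) :
    Decomp (fun V a b => chain V β l a b) :=
  (item ⟨verum σ, β, l, verum σ⟩).congr fun V a b _ => by simp [Item.Holds]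

theorem full (β : Q2MLO σ 1) : Decomp (fun V a b => full V β a b) := chain β []

theorem left {p : (σ → Set ℝ) → ℝ → Prop} (hp : UDef p) : Decomp (fun V a _ => p V a) := by
  obtain ⟨φ, hφ⟩ := hp
  exact (item ⟨φ, verum σ, [], verum σ⟩).congr fun V a b _ => by
    simp [Item.Holds, hφ, MetricLogic.chain, full_verum]

theorem right {p : (σ → Set ℝ) → ℝ → Prop} (hp : UDef p) : Decomp (fun V _ b => p V b) := by
  obtain ⟨φ, hφ⟩ := hp
  exact (item ⟨verum σ, verum σ, [], φ⟩).congr fun V a b _ => by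
    simp [Item.Holds, hφ, MetricLogic.chain, full_verum]

theorem false : Decomp (fun (_ : σ → Set ℝ) _ _ => False) := ⟨[], fun V a b _ => by simp⟩

theorem true : Decomp (fun (_ : σ → Set ℝ) _ _ => True) :=
  (full (verum σ)).congr fun V a b _ => iff_of_true (full_verum V a b) trivial

theorem or (hM : Decomp M) (hN : Decomp N) : Decomp (fun V a b => M V a b ∨ N V a b) := by
  obtain ⟨L, hL⟩ := hM
  obtain ⟨K, hK⟩ := hN
  exact ⟨L ++ K, fun V a b hab => by
    simp only [hL V a b hab, hK V a b hab, List.mem_append, or_and_right, exists_or]⟩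

theorem exists_mem {ι : Type*} (L : List ι) {f : ι → (σ → Set ℝ) → ℝ → ℝ → Prop}
    (h : ∀ i ∈ L, Decomp (f i)) : Decomp (fun V a b => ∃ i ∈ L, f i V a b) := by
  induction L with
  | nil => exact false.congr fun V a b _ => by simp
  | cons i L ih =>
    exact ((h i (by simp)).or (ih fun j hj => h j (by simp [hj]))).congr fun V a b _ => by simp

theorem chop (hM : Decomp M) (hN : Decomp N) :
    Decomp (fun V a b => ∃ x, a < x ∧ x < b ∧ M V a x ∧ N V x b) := by
  obtain ⟨L, hL⟩ := hM
  obtain ⟨K, hK⟩ := hN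
  have hitem : ∀ i j : Item σ,
      Decomp (fun V a b => ∃ x, a < x ∧ x < b ∧ i.Holds V a x ∧ j.Holds V x b) := fun i j =>
    (item ⟨i.left, i.gap, i.points ++ (.conj i.right j.left, j.gap) :: j.points,
      j.right⟩).congr fun V a b _ => by
        simp only [Item.Holds, chain_append, holds_conj]
        constructor
        · rintro ⟨h₁, ⟨x, hax, hxb, h₂, ⟨h₃, h₄⟩, h₅⟩, h₆⟩
          exact ⟨x, hax, hxb, ⟨h₁, h₂, h₃⟩, h₄, h₅, h₆⟩
        · rintro ⟨x, hax, hxb, ⟨h₁, h₂, h₃⟩, h₄, h₅, h₆⟩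
          exact ⟨h₁, ⟨x, hax, hxb, h₂, ⟨h₃, h₄⟩, h₅⟩, h₆⟩
  refine (exists_mem L fun i _ => exists_mem K fun j _ => hitem i j).congr fun V a b _ => ?_
  constructor
  · rintro ⟨i, hi, j, hj, x, hax, hxb, h₁, h₂⟩
    exact ⟨x, hax, hxb, (hL V a x hax).2 ⟨i, hi, h₁⟩, (hK V x b hxb).2 ⟨j, hj, h₂⟩⟩
  · rintro ⟨x, hax, hxb, h₁, h₂⟩
    obtain ⟨i, hi, h₁⟩ := (hL V a x hax).1 h₁
    obtain ⟨j, hj, h₂⟩ := (hK V x b hxb).1 h₂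
    exact ⟨i, hi, j, hj, x, hax, hxb, h₁, h₂⟩

theorem step (β α : Q2MLO σ 1) (hN : Decomp N) :
    Decomp (fun V a b => ∃ x, a < x ∧ x < b ∧ MetricLogic.full V β a x ∧ α.Holds V x ∧ N V x b) :=
  ((item ⟨verum σ, β, [], α⟩).chop hN).congr fun V a b _ => by
    simp [Item.Holds, MetricLogic.chain, and_assoc]

/-- Conjunction of two chain conditions, by comparing the positions of their first points. -/
theorem chain_and_chain : ∀ (n : ℕ) (β β' : Q2MLO σ 1) (l l' : List (Q2MLO σ 1 × Q2MLO σ 1)),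
    l.length + l'.length ≤ n →
    Decomp (fun V a b => MetricLogic.chain V β l a b ∧ MetricLogic.chain V β' l' a b) := by
  have full_conj : ∀ (V : σ → Set ℝ) (β β' : Q2MLO σ 1) (a b : ℝ),
      MetricLogic.full V (.conj β β') a b ↔
        MetricLogic.full V β a b ∧ MetricLogic.full V β' a b := fun V β β' a b => by
    simp only [MetricLogic.full, holds_conj]
    exact ⟨fun h => ⟨fun y h₁ h₂ => (h y h₁ h₂).1, fun y h₁ h₂ => (h y h₁ h₂).2⟩,
      fun h y h₁ h₂ => ⟨h.1 y h₁ h₂, h.2 y h₁ h₂⟩⟩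
  intro n
  induction n with
  | zero =>
    intro β β' l l' hn
    obtain rfl : l = [] := List.length_eq_zero_iff.1 (by lia)
    obtain rfl : l' = [] := List.length_eq_zero_iff.1 (by lia)
    exact (full (.conj β β')).congr fun V a b _ => full_conj V β β' a b
  | succ n ih =>
    -- the first point of `l'` precedes every point of `l`
    have before : ∀ (β β' : Q2MLO σ 1) (l : List (Q2MLO σ 1 × Q2MLO σ 1))
        (p : Q2MLO σ 1 × Q2MLO σ 1) (l' : List (Q2MLO σ 1 × Q2MLO σ 1)),
        l.length + (p :: l').length ≤ n + 1 →
        Decomp (fun V a b => ∃ x, a < x ∧ x < b ∧ MetricLogic.full V (.conj β β') a x ∧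
          (Q2MLO.conj β p.1).Holds V x ∧
          (MetricLogic.chain V β l x b ∧ MetricLogic.chain V p.2 l' x b)) :=
      fun β β' l p l' hn => step _ _ (ih _ _ _ _ (by simp only [List.length_cons] at hn; lia))
    have before' : ∀ {V : σ → Set ℝ} {β β' : Q2MLO σ 1} {l : List (Q2MLO σ 1 × Q2MLO σ 1)}
        {p : Q2MLO σ 1 × Q2MLO σ 1} {l' : List (Q2MLO σ 1 × Q2MLO σ 1)} {a b : ℝ},
        (∃ x, a < x ∧ x < b ∧ MetricLogic.full V (.conj β β') a x ∧
          (Q2MLO.conj β p.1).Holds V x ∧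
          (MetricLogic.chain V β l x b ∧ MetricLogic.chain V p.2 l' x b)) →
        MetricLogic.chain V β l a b ∧ MetricLogic.chain V β' (p :: l') a b := by
      rintro V β β' l p l' a b ⟨x, hax, hxb, hf, ⟨h₁, h₂⟩, h₃, h₄⟩
      obtain ⟨hf, hf'⟩ := (full_conj _ _ _ _ _).1 hf
      refine ⟨?_, x, hax, hxb, hf', h₂, h₄⟩
      cases l with
      | nil => exact hf.glue h₁ h₃
      | cons q l =>
        obtain ⟨y, hxy, hyb, hf₂, h₅⟩ := h₃
        exact ⟨y, hax.trans hxy, hyb, hf.glue h₁ hf₂, h₅⟩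
    intro β β' l l' hn
    cases l with
    | nil =>
      cases l' with
      | nil => exact (full (.conj β β')).congr fun V a b _ => full_conj V β β' a b
      | cons p l' =>
        refine (before β β' [] p l' hn).congr fun V a b _ => ⟨before', ?_⟩
        rintro ⟨h, x, hax, hxb, hf, hx, hc⟩
        exact ⟨x, hax, hxb, (full_conj _ _ _ _ _).2 ⟨h.mono le_rfl hxb.le, hf⟩, ⟨h x hax hxb, hx⟩,
          h.mono hax.le le_rfl, hc⟩
    | cons p l =>
      cases l' with
      | nil =>
        refine (before β' β [] p l (by simpa using hn)).congr fun V a b _ =>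
          ⟨fun h => (before' h).symm, ?_⟩
        rintro ⟨⟨x, hax, hxb, hf, hx, hc⟩, h⟩
        exact ⟨x, hax, hxb, (full_conj _ _ _ _ _).2 ⟨h.mono le_rfl hxb.le, hf⟩, ⟨h x hax hxb, hx⟩,
          h.mono hax.le le_rfl, hc⟩
      | cons q l' =>
        refine ((before β β' (p :: l) q l' hn).or ((before β' β (q :: l') p l
          (by simp only [List.length_cons] at hn ⊢; lia)).or (step (.conj β β') (.conj p.1 q.1)
            (ih p.2 q.2 l l' (by simp only [List.length_cons] at hn; lia))))).congr
          fun V a b _ => ⟨?_, ?_⟩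
        · rintro (h | h | ⟨x, hax, hxb, hf, ⟨h₁, h₂⟩, h₃, h₄⟩)
          · exact before' h
          · exact (before' h).symm
          · obtain ⟨hf, hf'⟩ := (full_conj _ _ _ _ _).1 hf
            exact ⟨⟨x, hax, hxb, hf, h₁, h₃⟩, x, hax, hxb, hf', h₂, h₄⟩
        · rintro ⟨⟨x, hax, hxb, hf, hx, hc⟩, y, hay, hyb, hg, hy, hd⟩
          rcases lt_trichotomy x y with h | rfl | h
          · exact .inr <| .inl ⟨x, hax, hxb, (full_conj _ _ _ _ _).2 ⟨hg.mono le_rfl h.le, hf⟩,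
              ⟨hg x hax h, hx⟩, ⟨y, h, hyb, hg.mono hax.le le_rfl, hy, hd⟩, hc⟩
          · exact .inr <| .inr ⟨x, hax, hxb, (full_conj _ _ _ _ _).2 ⟨hf, hg⟩, ⟨hx, hy⟩, hc, hd⟩
          · exact .inl ⟨y, hay, hyb, (full_conj _ _ _ _ _).2 ⟨hf.mono le_rfl h.le, hg⟩,
              ⟨hf y hay h, hy⟩, ⟨x, h, hxb, hf.mono hay.le le_rfl, hx, hc⟩, hd⟩

theorem and (hM : Decomp M) (hN : Decomp N) : Decomp (fun V a b => M V a b ∧ N V a b) := by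
  obtain ⟨L, hL⟩ := hM
  obtain ⟨K, hK⟩ := hN
  have hends : ∀ (A B : Q2MLO σ 1) {R : (σ → Set ℝ) → ℝ → ℝ → Prop}, Decomp R →
      Decomp (fun V a b => A.Holds V a ∧ R V a b ∧ B.Holds V b) := fun A B R hR => by
    obtain ⟨J, hJ⟩ := hR
    refine ⟨J.map fun i => ⟨.conj A i.left, i.gap, i.points, .conj B i.right⟩, fun V a b hab => ?_⟩
    simp only [hJ V a b hab, List.mem_map, exists_exists_and_eq_and, Item.Holds, holds_conj]
    constructor
    · rintro ⟨h₁, ⟨i, hi, h₂, h₃, h₄⟩, h₅⟩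
      exact ⟨i, hi, ⟨h₁, h₂⟩, h₃, h₅, h₄⟩
    · rintro ⟨i, hi, ⟨h₁, h₂⟩, h₃, h₅, h₄⟩
      exact ⟨h₁, ⟨i, hi, h₂, h₃, h₄⟩, h₅⟩
  refine (exists_mem L fun i _ => exists_mem K fun j _ =>
    hends (.conj i.left j.left) (.conj i.right j.right)
      (chain_and_chain _ i.gap j.gap i.points j.points le_rfl)).congr fun V a b hab => ?_
  rw [hL V a b hab, hK V a b hab]
  simp only [Item.Holds, holds_conj]
  constructor
  · rintro ⟨i, hi, j, hj, ⟨h₁, h₂⟩, ⟨h₃, h₄⟩, h₅, h₆⟩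
    exact ⟨⟨i, hi, h₁, h₃, h₅⟩, j, hj, h₂, h₄, h₆⟩
  · rintro ⟨⟨i, hi, h₁, h₃, h₅⟩, j, hj, h₂, h₄, h₆⟩
    exact ⟨i, hi, j, hj, ⟨h₁, h₂⟩, ⟨h₃, h₄⟩, h₅, h₆⟩

theorem forall_mem {ι : Type*} (L : List ι) {f : ι → (σ → Set ℝ) → ℝ → ℝ → Prop}
    (h : ∀ i ∈ L, Decomp (f i)) : Decomp (fun V a b => ∀ i ∈ L, f i V a b) := by
  induction L with
  | nil => exact true.congr fun V a b _ => by simp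
  | cons i L ih =>
    exact ((h i (by simp)).and (ih fun j hj => h j (by simp [hj]))).congr fun V a b _ => by simp

end Decomp

/-! ### Complements of decomposable relations -/

/-- Exchange argument: of two chains with an unconstrained last gap, the one that starts earlier
can be made to stop no later than the other. Where the two chains cross, the gap of the first
contains the gap of the second, so that one can change from the first to the second. -/
theorem chain_exchange {V : σ → Set ℝ} {b c : ℝ} (l : List (Q2MLO σ 1 × Q2MLO σ 1)) :
    ∀ {β : Q2MLO σ 1} {x x' : ℝ}, (∀ y, (lastGap β l).Holds V y) → x < x' →
      chain V β l x c → chain V β l x' b → chain V β l x b := by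
  induction l with
  | nil => intro β x x' htop _ _ _; exact fun y _ _ => htop y
  | cons p l ih =>
    rintro β x x' htop hx ⟨y, hxy, hyc, hf, hy, h⟩ ⟨y', hxy', hyb', hf', hy', h'⟩
    rcases lt_or_ge y y' with hlt | hle
    · exact ⟨y, hxy, hlt.trans hyb', hf, hy, ih htop hlt h h'⟩
    · exact ⟨y', hx.trans hxy', hyb', hf.mono le_rfl hle, hy', h'⟩

/-- The point `x` can serve as the first point of a chain with points `p :: l`, if no bound is put
on the right end of the chain. -/
def IsStart (V : σ → Set ℝ) (p : Q2MLO σ 1 × Q2MLO σ 1) (l : List (Q2MLO σ 1 × Q2MLO σ 1))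
    (x : ℝ) : Prop :=
  p.1.Holds V x ∧ ∃ c, x < c ∧ chain V p.2 l x c

theorem udef_isStart (p : Q2MLO σ 1 × Q2MLO σ 1) (l : List (Q2MLO σ 1 × Q2MLO σ 1)) :
    UDef (fun V x => IsStart V p l x) :=
  (UDef.holds p.1).and (bdef_chain l p.2).exists_gt

/-- Arbitrarily close to the right of `s` there are chains with points `pre ++ [p]` whose last point
can be continued to a chain with points `pre ++ p :: l`, possibly far away. -/
def Accumulates (V : σ → Set ℝ) (pre : List (Q2MLO σ 1 × Q2MLO σ 1)) (p : Q2MLO σ 1 × Q2MLO σ 1)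
    (l : List (Q2MLO σ 1 × Q2MLO σ 1)) (s : ℝ) : Prop :=
  ∀ y, s < y → ∃ x, s < x ∧ x < y ∧ chain V (verum σ) pre s x ∧ IsStart V p l x

theorem udef_accumulates (pre : List (Q2MLO σ 1 × Q2MLO σ 1)) (p : Q2MLO σ 1 × Q2MLO σ 1)
    (l : List (Q2MLO σ 1 × Q2MLO σ 1)) : UDef (fun V s => Accumulates V pre p l s) :=
  ((bdef_chain pre (verum σ)).chop (udef_isStart p l).left).not.exists_gt.not.congr fun V s => by
    simp only [Accumulates]
    push Not
    rfl

/-- If the points `pre ++ [p]` of a chain can be found arbitrarily close to the right of `s`, but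
the points `pre ++ [p, q]` cannot, then only the part of the chain after `p` matters. -/
theorem Accumulates.chain_iff {V : σ → Set ℝ} {pre l : List (Q2MLO σ 1 × Q2MLO σ 1)}
    {p q : Q2MLO σ 1 × Q2MLO σ 1} {s b : ℝ} (htop : ∀ y, (lastGap q.2 l).Holds V y)
    (hp : Accumulates V pre p (q :: l) s) (hq : ¬ Accumulates V (pre ++ [p]) q l s) :
    chain V (verum σ) (pre ++ p :: q :: l) s b ↔ chain V p.2 (q :: l) s b := by
  rw [chain_append]
  constructor
  · rintro ⟨x, hsx, hxb, -, -, hc⟩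
    simp only [Accumulates, not_forall] at hq
    obtain ⟨y₀, hy₀, hq⟩ := hq
    -- from every point near `s` where `p` is reached, the chain continues beyond `y₀`
    have key : ∀ w, s < w → ∃ u v, s < u ∧ u < w ∧ y₀ ≤ v ∧ v < b ∧ full V p.2 u v ∧
        q.1.Holds V v ∧ chain V q.2 l v b := by
      intro w hw
      obtain ⟨u, hsu, huw, hpre, hpu, c, huc, hcc⟩ := hp (min w x) (lt_min hw hsx)
      obtain ⟨v, huv, hvb, hf, hv, hvc⟩ :=
        chain_exchange (q :: l) htop (huw.trans_le (min_le_right w x)) hcc hc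
      refine ⟨u, v, hsu, huw.trans_le (min_le_left w x), ?_, hvb, hf, hv, hvc⟩
      by_contra! hlt
      exact hq ⟨v, hsu.trans huv, hlt, (chain_append ..).2 ⟨u, hsu, huv, hpre, hpu, hf⟩,
        hv, b, hvb, hvc⟩
    obtain ⟨u, v, hsu, huy, hyv, hvb, hf, hv, hvc⟩ := key y₀ hy₀
    refine ⟨v, hy₀.trans_le hyv, hvb, fun y hsy hyv' => ?_, hv, hvc⟩
    rcases lt_or_ge u y with huy' | hyu
    · exact hf y huy' hyv'
    · obtain ⟨u', v', -, huy', hyv'', -, hf', -⟩ := key y hsy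
      exact hf' y huy' (hyu.trans_lt (huy.trans_le hyv''))
  · rintro ⟨v, hsv, hvb, hf, hv, hvc⟩
    obtain ⟨u, hsu, huv, hpre, hpu, -⟩ := hp v hsv
    exact ⟨u, hsu, huv.trans hvb, hpre, hpu, v, huv, hvb, hf.mono hsu.le le_rfl, hv, hvc⟩

theorem decomp_accumulates_and_not_chain {n : ℕ}
    (ih : ∀ (β : Q2MLO σ 1) (l : List (Q2MLO σ 1 × Q2MLO σ 1)), l.length < n →
      Decomp (fun V a b => ¬ chain V β l a b))
    (l : List (Q2MLO σ 1 × Q2MLO σ 1)) : ∀ (pre : List (Q2MLO σ 1 × Q2MLO σ 1))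
      (p : Q2MLO σ 1 × Q2MLO σ 1), l.length < n →
      (∀ (V : σ → Set ℝ) y, (lastGap p.2 l).Holds V y) →
      Decomp (fun V a b => Accumulates V pre p l a ∧ ¬ chain V (verum σ) (pre ++ p :: l) a b) := by
  induction l with
  | nil =>
    intro pre p _ htop
    refine Decomp.false.congr fun V a b hab => ⟨False.elim, ?_⟩
    rintro ⟨h, hn⟩
    obtain ⟨x, hax, hxb, hpre, hx, -⟩ := h b hab
    exact hn ((chain_append ..).2 ⟨x, hax, hxb, hpre, hx, fun y _ _ => htop V y⟩)
  | cons q l ihl =>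
    intro pre p hn htop
    refine (((Decomp.left ((udef_accumulates pre p (q :: l)).and
      (udef_accumulates (pre ++ [p]) q l).not)).and (ih p.2 (q :: l) hn)).or
      ((Decomp.left (udef_accumulates pre p (q :: l))).and
        (ihl (pre ++ [p]) q (by simp only [List.length_cons] at hn; lia) htop))).congr
      fun V a b _ => ?_
    have happ : pre ++ [p] ++ q :: l = pre ++ p :: q :: l := by simp
    rw [happ]
    have hiff := Accumulates.chain_iff (V := V) (pre := pre) (p := p) (q := q) (l := l) (s := a)
      (b := b) (htop V)
    constructor
    · rintro (⟨⟨h₁, h₂⟩, h₃⟩ | ⟨h₁, -, h₃⟩)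
      · exact ⟨h₁, (hiff h₁ h₂).not.2 h₃⟩
      · exact ⟨h₁, h₃⟩
    · rintro ⟨h₁, h₃⟩
      by_cases h₂ : Accumulates V (pre ++ [p]) q l a
      · exact .inr ⟨h₁, h₂, h₃⟩
      · exact .inl ⟨⟨h₁, h₂⟩, (hiff h₁ h₂).not.1 h₃⟩

/-- The complement of a chain whose first and last gaps are unconstrained. Let `s` be the infimum
of the points of `(a, b)` at which such a chain can start. If `s` is itself such a point, then by
`chain_exchange` it may be taken as the first point; otherwise such points accumulate at `s`. -/
theorem decomp_not_chain_of_top {n : ℕ}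
    (ih : ∀ (β : Q2MLO σ 1) (l : List (Q2MLO σ 1 × Q2MLO σ 1)), l.length < n →
      Decomp (fun V a b => ¬ chain V β l a b))
    (l : List (Q2MLO σ 1 × Q2MLO σ 1)) (hn : l.length ≤ n)
    (htop : ∀ (V : σ → Set ℝ) y, (lastGap (verum σ) l).Holds V y) :
    Decomp (fun V a b => ¬ chain V (verum σ) l a b) := by
  cases l with
  | nil => exact Decomp.false.congr fun V a b _ => ⟨False.elim, fun h => h (full_verum V a b)⟩
  | cons p l =>
    obtain ⟨φ, hφ⟩ := (udef_isStart p l).not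
    have hacc := decomp_accumulates_and_not_chain ih l [] p hn htop
    refine ((Decomp.full φ).or (hacc.or ((Decomp.full φ).chop
      (((Decomp.left (udef_isStart p l)).and (ih p.2 l hn)).or
        ((Decomp.left (udef_isStart p l).not).and hacc))))).congr fun V a b hab => ?_
    simp only [List.nil_append]
    constructor
    · rintro (h | ⟨-, h⟩ | ⟨s, has, hsb, hf, h⟩)
      · rintro ⟨x, hax, hxb, -, hx, hc⟩
        exact (hφ V x).1 (h x hax hxb) ⟨hx, b, hxb, hc⟩
      · exact h
      · rintro ⟨x, hax, hxb, -, hx, hc⟩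
        have hsx : s ≤ x := by
          by_contra! hlt
          exact (hφ V x).1 (hf x hax hlt) ⟨hx, b, hxb, hc⟩
        rcases h with ⟨⟨hs, c, hsc, hcc⟩, hn⟩ | ⟨hs, -, hn⟩
        · rcases hsx.eq_or_lt with rfl | hlt
          · exact hn hc
          · exact hn (chain_exchange l (htop V) hlt hcc hc)
        · rcases hsx.eq_or_lt with rfl | hlt
          · exact hs ⟨hx, b, hxb, hc⟩
          · exact hn ⟨x, hlt, hxb, full_verum _ _ _, hx, hc⟩
    · intro hn
      have hA : ∀ s, (∀ y, s < y → ¬ full V φ s y) → Accumulates V [] p l s := by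
        intro s h y hy
        have := h y hy
        simp only [full, not_forall] at this
        obtain ⟨x, hsx, hxy, hx⟩ := this
        rw [hφ, not_not] at hx
        exact ⟨x, hsx, hxy, full_verum _ _ _, hx⟩
      by_cases hf : full V φ a b
      · exact .inl hf
      rcases exists_isRightExtent hf with h | ⟨s, has, hsb, hfs, hs⟩
      · exact .inr <| .inl ⟨hA a h, hn⟩
      · refine .inr <| .inr ⟨s, has, hsb, hfs, ?_⟩
        by_cases hstart : IsStart V p l s
        · exact .inl ⟨hstart, fun h => hn ⟨s, has, hsb, full_verum _ _ _, hstart.1, h⟩⟩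
        · exact .inr ⟨hstart, hA s (hs ((hφ V s).2 hstart)),
            fun h => hn (chain_verum_mono has.le h)⟩

/-- The complement of a chain whose last gap is satisfied throughout the interval. -/
theorem decomp_full_lastGap_and_not_chain {n : ℕ}
    (ih : ∀ (β : Q2MLO σ 1) (l : List (Q2MLO σ 1 × Q2MLO σ 1)), l.length < n →
      Decomp (fun V a b => ¬ chain V β l a b))
    (l : List (Q2MLO σ 1 × Q2MLO σ 1)) (hn : l.length ≤ n) :
    Decomp (fun V a b => full V (lastGap (verum σ) l) a b ∧ ¬ chain V (verum σ) l a b) := by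
  rcases List.eq_nil_or_concat l with rfl | ⟨l, p, rfl⟩
  · exact Decomp.false.congr fun V a b _ => ⟨False.elim, fun h => h.2 (full_verum V a b)⟩
  · refine ((Decomp.full p.2).and (decomp_not_chain_of_top ih (l ++ [(p.1, verum σ)])
      (by simpa using hn) fun V y => by rw [lastGap_append]; rfl)).congr fun V a b _ => ?_
    rw [List.concat_eq_append, lastGap_append]
    refine and_congr_right fun hf => not_congr ?_
    rw [chain_append, chain_append]
    refine exists_congr fun x => and_congr_right fun hax => and_congr_right fun _ =>
      and_congr_right fun _ => and_congr_right fun _ => ?_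
    exact iff_of_true (full_verum _ _ _) (hf.mono hax.le le_rfl)

/-- Refuting all splittings `rs` of a chain at a point `t`. Since `K` and `K'` determine `t`
uniquely, the splittings can be refuted one at a time, each at its own copy of `t`. -/
theorem decomp_exists_and_not_splits {K K' : (σ → Set ℝ) → ℝ → ℝ → Prop} {β : Q2MLO σ 1}
    (hK : Decomp K) (hK' : Decomp K')
    (huniq : ∀ V a b t t', a < t → t < b → a < t' → t' < b → K V a t → K' V t b → K V a t' →
      K' V t' b → t = t')
    (rs : List (Split σ))
    (hbefore : ∀ r ∈ rs, Decomp (fun V a t => K V a t ∧ ¬ chain V β r.before a t))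
    (hafter : ∀ r ∈ rs, Decomp (fun V t b => K' V t b ∧ ¬ chain V r.gap r.after t b)) :
    Decomp (fun V a b => ∃ t, a < t ∧ t < b ∧ K V a t ∧ K' V t b ∧
      ∀ r ∈ rs, ¬ r.Holds V β a t b) := by
  refine ((hK.chop hK').and (Decomp.forall_mem rs fun r hr => ((hbefore r hr).chop hK').or
    (((hK.and (Decomp.right (UDef.holds r.mid).not)).chop hK').or
      (hK.chop (hafter r hr))))).congr fun V a b _ => ?_
  constructor
  · rintro ⟨⟨t, hat, htb, h₁, h₂⟩, h⟩
    refine ⟨t, hat, htb, h₁, h₂, fun r hr hh => ?_⟩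
    rcases h r hr with ⟨t', hat', htb', ⟨h₁', hn⟩, h₂'⟩ | ⟨t', hat', htb', ⟨h₁', hn⟩, h₂'⟩ |
      ⟨t', hat', htb', h₁', h₂', hn⟩ <;>
      obtain rfl := huniq V a b t t' hat htb hat' htb' h₁ h₂ h₁' h₂'
    exacts [hn hh.1, hn hh.2.1, hn hh.2.2]
  · rintro ⟨t, hat, htb, h₁, h₂, h⟩
    refine ⟨⟨t, hat, htb, h₁, h₂⟩, fun r hr => ?_⟩
    by_cases hc : chain V β r.before a t
    · by_cases hm : r.mid.Holds V t
      · exact .inr <| .inr ⟨t, hat, htb, h₁, h₂, fun hc' => h r hr ⟨hc, hm, hc'⟩⟩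
      · exact .inr <| .inl ⟨t, hat, htb, ⟨h₁, hm⟩, h₂⟩
    · exact .inl ⟨t, hat, htb, ⟨h₁, hc⟩, h₂⟩

theorem chain.exists_full_lastGap {V : σ → Set ℝ} {b : ℝ} {l : List (Q2MLO σ 1 × Q2MLO σ 1)} :
    ∀ {β : Q2MLO σ 1} {a : ℝ}, a < b → chain V β l a b →
      ∃ y, a ≤ y ∧ y < b ∧ full V (lastGap β l) y b := by
  induction l with
  | nil => intro β a hab h; exact ⟨a, le_rfl, hab, h⟩
  | cons p l ih =>
    rintro β a hab ⟨x, hax, hxb, -, -, h⟩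
    obtain ⟨y, hxy, hyb, hf⟩ := ih hxb h
    exact ⟨y, hax.le.trans hxy, hyb, hf⟩

/-- The complement of a chain whose first gap is unconstrained: split it at the left extent of its
last gap. -/
theorem decomp_not_chain_verum {n : ℕ}
    (ih : ∀ (β : Q2MLO σ 1) (l : List (Q2MLO σ 1 × Q2MLO σ 1)), l.length < n →
      Decomp (fun V a b => ¬ chain V β l a b))
    (l : List (Q2MLO σ 1 × Q2MLO σ 1)) (hn : l.length ≤ n) :
    Decomp (fun V a b => ¬ chain V (verum σ) l a b) := by
  by_cases hl : l = []
  · subst hl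
    exact Decomp.false.congr fun V a b _ => ⟨False.elim, fun h => h (full_verum V a b)⟩
  set γ := lastGap (verum σ) l with hγ
  have hext : Decomp (fun V t b => IsLeftExtent V γ t b) :=
    (Decomp.full γ).and (Decomp.left (udef_leftEnd γ))
  have hsplit := decomp_exists_and_not_splits (β := verum σ) Decomp.true hext
    (fun V a b t t' _ h₁ _ h₂ _ h₃ _ h₄ => h₃.unique h₁ h₂ h₄)
    ((splits (verum σ) l).filter fun r => r.before.length < l.length) ?_ ?_
  · refine ((decomp_full_lastGap_and_not_chain ih l hn).or
      ((Decomp.right (udef_not_full_left γ)).or hsplit)).congr fun V a b hab => ?_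
    constructor
    · rintro (⟨-, h⟩ | h | ⟨t, hat, htb, -, ht, h⟩) hc
      · exact h hc
      · obtain ⟨y, -, hyb, hf⟩ := hc.exists_full_lastGap hab
        exact h y hyb hf
      · obtain ⟨r, hr, hlt, hh⟩ := exists_split_of_isLeftExtent htb hl hat ht hc
        exact h r (List.mem_filter.2 ⟨hr, by simpa using hlt⟩) hh
    · intro hc
      by_cases hf : full V γ a b
      · exact .inl ⟨hf, hc⟩
      rcases exists_isLeftExtent hf with h | ⟨t, hat, htb, ht⟩
      · exact .inr (.inl h)
      · refine .inr (.inr ⟨t, hat, htb, trivial, ht, fun r hr hh => hc ?_⟩)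
        exact hh.chain htb hat (List.mem_filter.1 hr).1
  · intro r hr
    have hlt : r.before.length < l.length := by simpa using (List.mem_filter.1 hr).2
    exact Decomp.true.and (ih _ _ (hlt.trans_le hn))
  · intro r hr
    rcases splits_after (List.mem_filter.1 hr).1 with rfl | h
    · exact ((decomp_full_lastGap_and_not_chain ih l hn).and (Decomp.left (udef_leftEnd γ))).congr
        fun V a b _ => and_right_comm
    · exact hext.and (ih _ _ (h.trans_le hn))

/-- The complement of a chain is decomposable: split the chain at the right extent of its first
gap. -/
theorem decomp_not_chain : ∀ (n : ℕ) (β : Q2MLO σ 1) (l : List (Q2MLO σ 1 × Q2MLO σ 1)),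
    l.length < n → Decomp (fun V a b => ¬ chain V β l a b) := by
  intro n
  induction n with
  | zero => intro β l hn; exact absurd hn (Nat.not_lt_zero _)
  | succ n ih =>
    intro β l hn
    have hn : l.length ≤ n := Nat.lt_succ_iff.1 hn
    by_cases hl : l = []
    · subst hl
      refine (Decomp.true.chop (Decomp.left (UDef.holds β).not)).congr fun V a b _ => ?_
      simp [chain, full]
    have hext : Decomp (fun V a s => IsRightExtent V β a s) :=
      (Decomp.full β).and (Decomp.right (udef_rightEnd β))
    have hsplit := decomp_exists_and_not_splits (β := β) hext Decomp.true
      (fun V a b t t' h₁ _ h₂ _ h₃ _ h₄ _ => h₃.unique h₁ h₂ h₄)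
      ((splits β l).filter fun r => r.after.length < l.length) ?_ ?_
    · refine (((Decomp.full β).and (decomp_not_chain_verum ih l hn)).or
        ((Decomp.left (udef_not_full_right β)).or hsplit)).congr fun V a b _ => ?_
      constructor
      · rintro (⟨hf, h⟩ | h | ⟨t, hat, htb, ht, -, h⟩) hc
        · exact h ((hf.chain_congr_left l).1 hc)
        · obtain ⟨p, l, rfl⟩ := List.exists_cons_of_ne_nil hl
          obtain ⟨x, hax, -, hf, -⟩ := hc
          exact h x hax hf
        · obtain ⟨r, hr, hlt, hh⟩ := exists_split_of_isRightExtent hl hat htb ht hc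
          exact h r (List.mem_filter.2 ⟨hr, by simpa using hlt⟩) hh
      · intro hc
        by_cases hf : full V β a b
        · exact .inl ⟨hf, fun h => hc ((hf.chain_congr_left l).2 h)⟩
        rcases exists_isRightExtent hf with h | ⟨t, hat, htb, ht⟩
        · exact .inr (.inl h)
        · refine .inr (.inr ⟨t, hat, htb, ht, trivial, fun r hr hh => hc ?_⟩)
          exact hh.chain htb hat (List.mem_filter.1 hr).1
    · intro r hr
      refine (hext.and (decomp_not_chain_verum ih r.before
        ((splits_before_length (List.mem_filter.1 hr).1).trans hn))).congr fun V a b _ => ?_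
      exact and_congr_right fun h => (h.1.chain_congr_left _).symm.not
    · intro r hr
      have hlt : r.after.length < l.length := by simpa using (List.mem_filter.1 hr).2
      exact Decomp.true.and (ih _ _ (hlt.trans_le hn))

theorem Decomp.not {M : (σ → Set ℝ) → ℝ → ℝ → Prop} (hM : Decomp M) :
    Decomp (fun V a b => ¬ M V a b) := by
  obtain ⟨L, hL⟩ := hM
  refine (Decomp.forall_mem L fun i _ => (Decomp.left (UDef.holds i.left).not).or
    ((decomp_not_chain _ i.gap i.points (Nat.lt_succ_self _)).or
      (Decomp.right (UDef.holds i.right).not))).congr fun V a b hab => ?_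
  rw [hL V a b hab]
  simp only [Item.Holds]
  push Not
  exact forall₂_congr fun i _ => by tauto

/-! ### Relations that can be inspected from the two ends separately -/

/-- The Boolean combinations, on pairs `a < b`, of the relations `∃ y ∈ (a, b), M(a, y)` and
`∃ y ∈ (a, b), M(y, b)` with `M` definable. When `b = a + 1`, these are within reach of the metric
quantifiers at `a` and at `b`. -/
inductive TwoSided : ((σ → Set ℝ) → ℝ → ℝ → Prop) → Prop
  | fromLeft {M : (σ → Set ℝ) → ℝ → ℝ → Prop} (hM : BDef M) :
      TwoSided fun V a b => ∃ y, a < y ∧ y < b ∧ M V a y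
  | fromRight {M : (σ → Set ℝ) → ℝ → ℝ → Prop} (hM : BDef M) :
      TwoSided fun V a b => ∃ y, a < y ∧ y < b ∧ M V y b
  | not {M : (σ → Set ℝ) → ℝ → ℝ → Prop} (hM : TwoSided M) : TwoSided fun V a b => ¬ M V a b
  | and {M N : (σ → Set ℝ) → ℝ → ℝ → Prop} (hM : TwoSided M) (hN : TwoSided N) :
      TwoSided fun V a b => M V a b ∧ N V a b
  | congr {M N : (σ → Set ℝ) → ℝ → ℝ → Prop} (hM : TwoSided M)
      (h : ∀ V a b, a < b → (M V a b ↔ N V a b)) : TwoSided N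

theorem TwoSided.udef {M : (σ → Set ℝ) → ℝ → ℝ → Prop} (hM : TwoSided M) :
    UDef (fun V z => M V z (z + 1)) := by
  induction hM with
  | fromLeft hM => exact hM.exists_next
  | fromRight hM => exact hM.exists_prev.next.congr fun V z => by rw [add_sub_cancel_right]
  | not _ ih => exact ih.not
  | and _ _ ih₁ ih₂ => exact ih₁.and ih₂
  | congr _ h ih => exact ih.congr fun V z => h V z (z + 1) (lt_add_one z)

namespace TwoSided

variable {M N : (σ → Set ℝ) → ℝ → ℝ → Prop}

theorem or (hM : TwoSided M) (hN : TwoSided N) : TwoSided (fun V a b => M V a b ∨ N V a b) :=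
  (hM.not.and hN.not).not.congr fun _ _ _ _ => by tauto

theorem left {p : (σ → Set ℝ) → ℝ → Prop} (hp : UDef p) : TwoSided (fun V a _ => p V a) :=
  (fromLeft hp.left).congr fun _ _ _ hab =>
    ⟨fun ⟨_, _, _, h⟩ => h, fun h => let ⟨y, h₁, h₂⟩ := exists_between hab; ⟨y, h₁, h₂, h⟩⟩

theorem right {p : (σ → Set ℝ) → ℝ → Prop} (hp : UDef p) : TwoSided (fun V _ b => p V b) :=
  (fromRight hp.right).congr fun _ _ _ hab =>
    ⟨fun ⟨_, _, _, h⟩ => h, fun h => let ⟨y, h₁, h₂⟩ := exists_between hab; ⟨y, h₁, h₂, h⟩⟩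

theorem exists_mem {ι : Type*} (L : List ι) {f : ι → (σ → Set ℝ) → ℝ → ℝ → Prop}
    (h : ∀ i ∈ L, TwoSided (f i)) : TwoSided (fun V a b => ∃ i ∈ L, f i V a b) := by
  induction L with
  | nil => exact (left (UDef.holds (verum σ)).not).congr fun V a b _ => by simp
  | cons i L ih =>
    exact ((h i (by simp)).or (ih fun j hj => h j (by simp [hj]))).congr fun V a b _ => by simp

theorem full (β : Q2MLO σ 1) : TwoSided (fun V a b => full V β a b) :=
  (fromLeft (UDef.holds β).not.right).not.congr fun V a b _ => by
    simp [MetricLogic.full]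

end TwoSided

theorem IsLeftExtent.exists_not_holds {V : σ → Set ℝ} {β : Q2MLO σ 1} {y t b : ℝ}
    (h : IsLeftExtent V β t b) (hy : y < t) : ∃ z, y < z ∧ z ≤ t ∧ ¬ β.Holds V z := by
  by_cases ht : β.Holds V t
  · have := h.2 ht y hy
    simp only [full, not_forall] at this
    obtain ⟨z, hyz, hzt, hz⟩ := this
    exact ⟨z, hyz, hzt.le, hz⟩
  · exact ⟨t, hy, le_rfl, ht⟩

theorem IsRightExtent.exists_not_holds {V : σ → Set ℝ} {β : Q2MLO σ 1} {a s y : ℝ}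
    (h : IsRightExtent V β a s) (hy : s < y) : ∃ z, s ≤ z ∧ z < y ∧ ¬ β.Holds V z := by
  by_cases hs : β.Holds V s
  · have := h.2 hs y hy
    simp only [full, not_forall] at this
    obtain ⟨z, hsz, hzy, hz⟩ := this
    exact ⟨z, hsz.le, hzy, hz⟩
  · exact ⟨s, le_rfl, hy, hs⟩

theorem full.le_of_not_holds {V : σ → Set ℝ} {β : Q2MLO σ 1} {t b z : ℝ} (h : full V β t b)
    (hzb : z < b) (hz : ¬ β.Holds V z) : z ≤ t := by
  by_contra! hlt
  exact hz (h z hlt hzb)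

theorem full.ge_of_not_holds {V : σ → Set ℝ} {β : Q2MLO σ 1} {a s z : ℝ} (h : full V β a s)
    (haz : a < z) (hz : ¬ β.Holds V z) : s ≤ z := by
  by_contra! hlt
  exact hz (h z haz hlt)

/-- Relativisation to the interval between the extents `s` of `β` to the right of `a` and `t` of
`β'` to the left of `b`. An observer at `a` recognises the points before `t`: these are the points
followed by a failure of `β'` before `b`. Likewise for an observer at `b`. -/
theorem TwoSided.between_extents (β β' : Q2MLO σ 1) {M : (σ → Set ℝ) → ℝ → ℝ → Prop}
    (hM : TwoSided M) : TwoSided (fun V a b => ∃ s t, a < s ∧ s < t ∧ t < b ∧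
      IsRightExtent V β a s ∧ IsLeftExtent V β' t b ∧ M V s t) := by
  have hR := bdef_isRightExtent β
  have hL := bdef_isLeftExtent β'
  have hβ := (UDef.holds β).not
  have hβ' := (UDef.holds β').not
  have base : TwoSided (fun V a b => ∃ s t, a < s ∧ s < t ∧ t < b ∧
      IsRightExtent V β a s ∧ IsLeftExtent V β' t b) := by
    refine ((fromRight hL).and (fromLeft (hR.chop hβ'.right))).congr fun V a b _ => ?_
    constructor
    · rintro ⟨⟨t, _, htb, ht⟩, y, _, hyb, s, has, hsy, hs, hy⟩
      exact ⟨s, t, has, hsy.trans_le (ht.1.le_of_not_holds hyb hy), htb, hs, ht⟩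
    · rintro ⟨s, t, has, hst, htb, hs, ht⟩
      obtain ⟨y, hsy, hyt, hy⟩ := ht.exists_not_holds hst
      exact ⟨⟨t, has.trans hst, htb, ht⟩, y, has.trans hsy, hyt.trans_lt htb, s, has, hsy, hs, hy⟩
  induction hM with
  | @fromLeft M hM =>
    refine (base.and (fromLeft ((hR.chop hM).chop hβ'.right))).congr fun V a b _ => ?_
    constructor
    · rintro ⟨⟨s, t, has, hst, htb, hs, ht⟩, y', _, hyb', y, hay, hyy',
        ⟨s', has', hsy', hs', h⟩, hy'⟩
      obtain rfl := hs.unique has has' hs'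
      exact ⟨s, t, has, hst, htb, hs, ht, y, hsy', hyy'.trans_le (ht.1.le_of_not_holds hyb' hy'), h⟩
    · rintro ⟨s, t, has, hst, htb, hs, ht, y, hsy, hyt, h⟩
      obtain ⟨y', hyy', hyt', hy'⟩ := ht.exists_not_holds hyt
      exact ⟨⟨s, t, has, hst, htb, hs, ht⟩, y', (has.trans hsy).trans hyy', hyt'.trans_lt htb, y,
        has.trans hsy, hyy', ⟨s, has, hsy, hs, h⟩, hy'⟩
  | @fromRight M hM =>
    refine (base.and (fromRight (hβ.left.chop (hM.chop hL)))).congr fun V a b _ => ?_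
    constructor
    · rintro ⟨⟨s, t, has, hst, htb, hs, ht⟩, y', hay', _, y, hyy', hyb, hy', t', hyt', htb', h, ht'⟩
      obtain rfl := ht.unique htb htb' ht'
      exact ⟨s, t, has, hst, htb, hs, ht, y, (hs.1.ge_of_not_holds hay' hy').trans_lt hyy', hyt', h⟩
    · rintro ⟨s, t, has, hst, htb, hs, ht, y, hsy, hyt, h⟩
      obtain ⟨y', hsy', hyy', hy'⟩ := hs.exists_not_holds hsy
      exact ⟨⟨s, t, has, hst, htb, hs, ht⟩, y', has.trans_le hsy', hyy'.trans (hyt.trans htb), y,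
        hyy', hyt.trans htb, hy', t, hyt, htb, h, ht⟩
  | not _ ih =>
    refine (base.and ih.not).congr fun V a b _ => ?_
    constructor
    · rintro ⟨⟨s, t, has, hst, htb, hs, ht⟩, h⟩
      exact ⟨s, t, has, hst, htb, hs, ht, fun h' => h ⟨s, t, has, hst, htb, hs, ht, h'⟩⟩
    · rintro ⟨s, t, has, hst, htb, hs, ht, h⟩
      refine ⟨⟨s, t, has, hst, htb, hs, ht⟩, ?_⟩
      rintro ⟨s', t', has', _, htb', hs', ht', h'⟩
      obtain rfl := hs.unique has has' hs'
      obtain rfl := ht.unique htb htb' ht'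
      exact h h'
  | and _ _ ih₁ ih₂ =>
    refine (ih₁.and ih₂).congr fun V a b _ => ?_
    constructor
    · rintro ⟨⟨s, t, has, hst, htb, hs, ht, h⟩, s', t', has', _, htb', hs', ht', h'⟩
      obtain rfl := hs.unique has has' hs'
      obtain rfl := ht.unique htb htb' ht'
      exact ⟨s, t, has, hst, htb, hs, ht, h, h'⟩
    · rintro ⟨s, t, has, hst, htb, hs, ht, h, h'⟩
      exact ⟨⟨s, t, has, hst, htb, hs, ht, h⟩, s, t, has, hst, htb, hs, ht, h'⟩
  | congr _ h ih =>
    refine ih.congr fun V a b _ => exists₂_congr fun s t => ?_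
    exact and_congr_right fun _ => and_congr_right fun hst => and_congr_right fun _ =>
      and_congr_right fun _ => and_congr_right fun _ => h V s t hst

/-- A chain to the right of an extent `s`, when the last gap of the chain is satisfied from `s`
on. The remaining conditions are all visible from the left end. -/
theorem TwoSided.exists_isRightExtent_and_chain (β : Q2MLO σ 1)
    {D : (σ → Set ℝ) → ℝ → ℝ → Prop} (hD : BDef D) (β' : Q2MLO σ 1)
    (l : List (Q2MLO σ 1 × Q2MLO σ 1)) :
    TwoSided (fun V a b => ∃ s, a < s ∧ s < b ∧ IsRightExtent V β a s ∧ D V a s ∧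
      MetricLogic.full V (lastGap β' l) s b ∧ chain V β' l s b) := by
  have hR := bdef_isRightExtent β
  have base : ∀ γ : Q2MLO σ 1, TwoSided (fun V a b => ∃ s, a < s ∧ s < b ∧
      IsRightExtent V β a s ∧ D V a s ∧ MetricLogic.full V γ s b) := fun γ => by
    refine ((fromLeft (hR.and hD)).and
      (fromLeft (hR.chop (UDef.holds γ).not.right)).not).congr fun V a b _ => ?_
    constructor
    · rintro ⟨⟨s, has, hsb, hs, hd⟩, hn⟩
      refine ⟨s, has, hsb, hs, hd, fun y hsy hyb => ?_⟩
      by_contra hy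
      exact hn ⟨y, has.trans hsy, hyb, s, has, hsy, hs, hy⟩
    · rintro ⟨s, has, hsb, hs, hd, hf⟩
      refine ⟨⟨s, has, hsb, hs, hd⟩, ?_⟩
      rintro ⟨y, _, hyb, s', has', hsy', hs', hy⟩
      obtain rfl := hs.unique has has' hs'
      exact hy (hf y hsy' hyb)
  rcases List.eq_nil_or_concat l with rfl | ⟨l, q, rfl⟩
  · exact (base β').congr fun V a b _ => by simp only [lastGap, chain, and_self]
  · rw [List.concat_eq_append, lastGap_append]
    refine ((base q.2).and (fromLeft (hR.chop
      ((bdef_chain l β').and (UDef.holds q.1).right)))).congr fun V a b _ => ?_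
    simp only [chain_append, lastGap]
    constructor
    · rintro ⟨⟨s, has, hsb, hs, hd, hf⟩, y, _, hyb, s', has', hsy, hs', hc, hq⟩
      obtain rfl := hs.unique has has' hs'
      exact ⟨s, has, hsb, hs, hd, hf, y, hsy, hyb, hc, hq, hf.mono hsy.le le_rfl⟩
    · rintro ⟨s, has, hsb, hs, hd, hf, y, hsy, hyb, hc, hq, -⟩
      exact ⟨⟨s, has, hsb, hs, hd, hf⟩, y, has.trans hsy, hyb, s, has, hsy, hs, hc, hq⟩

/-- Chain conditions can be inspected from the two ends. If the first gap is satisfied throughout,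
the right end sees everything; if the last gap is satisfied from the extent of the first gap on, the
left end does. Otherwise the extents of the two gaps cut the interval into three parts, of which
the outer ones are seen from their ends, and the middle one contains a shorter chain. -/
theorem twoSided_chain : ∀ (n : ℕ) (β : Q2MLO σ 1) (l : List (Q2MLO σ 1 × Q2MLO σ 1)),
    l.length < n → TwoSided (fun V a b => chain V β l a b) := by
  intro n
  induction n with
  | zero => intro β l hn; exact absurd hn (Nat.not_lt_zero _)
  | succ n ih =>
    intro β l hn
    have hn : l.length ≤ n := Nat.lt_succ_iff.1 hn
    cases l with
    | nil => exact TwoSided.full β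
    | cons p l =>
    set m := p :: l with hm
    have hml : m ≠ [] := List.cons_ne_nil _ _
    set γ := lastGap β m with hγ
    have h₁ : TwoSided (fun V a b => full V β a b ∧
        ∃ x, a < x ∧ x < b ∧ p.1.Holds V x ∧ chain V p.2 l x b) :=
      (TwoSided.full β).and (.fromRight ((UDef.holds p.1).left.and (bdef_chain l p.2)))
    have h₂ : TwoSided (fun V a b => ∃ r ∈ splits β m, ∃ s, a < s ∧ s < b ∧
        IsRightExtent V β a s ∧ (chain V β r.before a s ∧ r.mid.Holds V s) ∧
        full V (lastGap r.gap r.after) s b ∧ chain V r.gap r.after s b) :=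
      TwoSided.exists_mem _ fun r _ => TwoSided.exists_isRightExtent_and_chain β
        ((bdef_chain r.before β).and (UDef.holds r.mid).right) r.gap r.after
    have h₃ : TwoSided (fun V a b => ∃ r ∈ (splits β m).filter (fun r => r.after.length < m.length),
        ∃ r' ∈ splits r.gap r.after,
          (∃ s t, a < s ∧ s < t ∧ t < b ∧ IsRightExtent V β a s ∧ IsLeftExtent V γ t b ∧
            chain V r.gap r'.before s t) ∧
          (∃ s, a < s ∧ s < b ∧ IsRightExtent V β a s ∧ chain V β r.before a s ∧ r.mid.Holds V s) ∧
          ∃ t, a < t ∧ t < b ∧ IsLeftExtent V γ t b ∧ r'.mid.Holds V t ∧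
            chain V r'.gap r'.after t b) := by
      refine TwoSided.exists_mem _ fun r hr => TwoSided.exists_mem _ fun r' hr' => ?_
      have hlt : r.after.length < m.length := by simpa using (List.mem_filter.1 hr).2
      exact ((ih r.gap r'.before (((splits_before_length hr').trans_lt hlt).trans_le
        hn)).between_extents β γ).and
        ((TwoSided.fromLeft ((bdef_isRightExtent β).and
          ((bdef_chain r.before β).and (UDef.holds r.mid).right))).and
        (.fromRight ((bdef_isLeftExtent γ).and
          ((UDef.holds r'.mid).left.and (bdef_chain r'.after r'.gap)))))
    refine (h₁.or (h₂.or h₃)).congr fun V a b hab => ?_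
    constructor
    · rintro (⟨hf, x, hax, hxb, hx, hc⟩ | ⟨r, hr, s, has, hsb, -, ⟨h, h'⟩, -, h''⟩ |
        ⟨r, hr, r', hr', ⟨s, t, has, hst, htb, hs, ht, h⟩, ⟨s', has', _, hs', hc⟩,
          t', _, htb', ht', hc'⟩)
      · exact ⟨x, hax, hxb, hf.mono le_rfl hxb.le, hx, hc⟩
      · exact Split.Holds.chain hsb has hr ⟨h, h', h''⟩
      · obtain rfl := hs.unique has has' hs'
        obtain rfl := ht.unique htb htb' ht'
        exact Split.Holds.chain (hst.trans htb) has (List.mem_filter.1 hr).1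
          ⟨hc.1, hc.2, Split.Holds.chain htb hst hr' ⟨h, hc'⟩⟩
    · intro hc
      by_cases hf : full V β a b
      · obtain ⟨x, hax, hxb, -, hx⟩ := hc
        exact .inl ⟨hf, x, hax, hxb, hx⟩
      rcases exists_isRightExtent hf with h | ⟨s, has, hsb, hs⟩
      · obtain ⟨x, hax, -, hf', -⟩ := hc
        exact (h x hax hf').elim
      obtain ⟨r, hr, hlt, hr₁, hr₂, hr₃⟩ := exists_split_of_isRightExtent hml has hsb hs hc
      by_cases hg : full V γ s b
      · exact .inr <| .inl ⟨r, hr, s, has, hsb, hs, ⟨hr₁, hr₂⟩, by rwa [splits_lastGap hr], hr₃⟩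
      rcases exists_isLeftExtent hg with h | ⟨t, hst, htb, ht⟩
      · obtain ⟨y, -, hyb, hf'⟩ := hc.exists_full_lastGap hab
        exact (h y hyb hf').elim
      · obtain ⟨r', hr', h₁', h₂', h₃'⟩ := exists_split htb hst hr₃
        exact .inr <| .inr ⟨r, List.mem_filter.2 ⟨hr, by simpa using hlt⟩, r', hr',
          ⟨s, t, has, hst, htb, hs, ht, h₁'⟩, ⟨s, has, hsb, hs, hr₁, hr₂⟩,
          t, has.trans hst, htb, ht, h₂', h₃'⟩

/-- A decomposable relation between `z` and `z + 1` is a definable property of `z`. -/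
theorem Decomp.udef {M : (σ → Set ℝ) → ℝ → ℝ → Prop} (hM : Decomp M) :
    UDef (fun V z => M V z (z + 1)) := by
  obtain ⟨L, hL⟩ := hM
  have h : TwoSided (fun V a b => ∃ i ∈ L, i.Holds V a b) :=
    TwoSided.exists_mem L fun i _ => (TwoSided.left (UDef.holds i.left)).and
      ((twoSided_chain _ i.gap i.points (Nat.lt_succ_self _)).and
        (TwoSided.right (UDef.holds i.right)))
  exact h.udef.congr fun V z => (hL V z (z + 1) (lt_add_one z)).symm

/-! ### Relations between the points of a subdivision of `[z, z + 1]` -/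

/-- The first `m + 2` terms of the sequence `p` subdivide the interval `[p 0, p 0 + 1]`. -/
def IsSubdivision (m : ℕ) (p : ℕ → ℝ) : Prop :=
  (∀ j ≤ m, p j < p (j + 1)) ∧ p (m + 1) = p 0 + 1

/-- On the subdivisions with `m + 2` points, `R` is a finite union of conjunctions of decomposable
relations between consecutive points. -/
def Piecewise (m : ℕ) (R : (σ → Set ℝ) → (ℕ → ℝ) → Prop) : Prop :=
  ∃ L : List (ℕ → (σ → Set ℝ) → ℝ → ℝ → Prop), (∀ M ∈ L, ∀ j, Decomp (M j)) ∧
    ∀ V p, IsSubdivision m p → (R V p ↔ ∃ M ∈ L, ∀ j ≤ m, M j V (p j) (p (j + 1)))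

theorem IsSubdivision.lt {m : ℕ} {p : ℕ → ℝ} (hp : IsSubdivision m p) {i j : ℕ} (hij : i < j)
    (hj : j ≤ m + 1) : p i < p j := by
  induction j, hij using Nat.le_induction with
  | base => exact hp.1 i (by lia)
  | succ j hij ih => exact (ih (by lia)).trans (hp.1 j (by lia))

theorem IsSubdivision.zero_le {m : ℕ} {p : ℕ → ℝ} (hp : IsSubdivision m p) {i : ℕ} (hi : i ≤ m) :
    p 0 ≤ p i := by
  rcases i.eq_zero_or_pos with rfl | h
  · exact le_rfl
  · exact (hp.lt h (by lia)).le

theorem IsSubdivision.lt_add_one {m : ℕ} {p : ℕ → ℝ} (hp : IsSubdivision m p) {i : ℕ}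
    (hi : i ≤ m) : p i < p 0 + 1 :=
  hp.2 ▸ hp.lt (Nat.lt_succ_of_le hi) le_rfl

theorem IsSubdivision.exists_mem_Ico {m : ℕ} {p : ℕ → ℝ} (hp : IsSubdivision m p) {x : ℝ}
    (h₀ : p 0 ≤ x) (h₁ : x < p 0 + 1) : ∃ i ≤ m, p i ≤ x ∧ x < p (i + 1) := by
  have key : ∀ k, x < p (k + 1) → ∃ i ≤ k, p i ≤ x ∧ x < p (i + 1) := by
    intro k
    induction k with
    | zero => exact fun h => ⟨0, le_rfl, h₀, h⟩
    | succ k ih =>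
      intro h
      rcases lt_or_ge x (p (k + 1)) with hlt | hle
      · obtain ⟨i, hi, h'⟩ := ih hlt
        exact ⟨i, hi.trans k.le_succ, h'⟩
      · exact ⟨k + 1, le_rfl, hle, h⟩
  exact key m (hp.2 ▸ h₁)

/-- The sequence obtained from `p` by inserting `x` after the `i`-th term. -/
def insertPoint (p : ℕ → ℝ) (i : ℕ) (x : ℝ) (j : ℕ) : ℝ :=
  if j ≤ i then p j else if j = i + 1 then x else p (j - 1)

theorem insertPoint_of_le {p : ℕ → ℝ} {i : ℕ} {x : ℝ} {j : ℕ} (h : j ≤ i) :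
    insertPoint p i x j = p j := if_pos h

@[simp] theorem insertPoint_self (p : ℕ → ℝ) (i : ℕ) (x : ℝ) : insertPoint p i x (i + 1) = x := by
  simp [insertPoint]

theorem insertPoint_succ_of_lt {p : ℕ → ℝ} {i : ℕ} {x : ℝ} {j : ℕ} (h : i < j) :
    insertPoint p i x (j + 1) = p j := by
  rw [insertPoint, if_neg (by lia), if_neg (by lia), Nat.add_sub_cancel]

theorem IsSubdivision.insertPoint {m : ℕ} {p : ℕ → ℝ} (hp : IsSubdivision m p) {i : ℕ}
    (hi : i ≤ m) {x : ℝ} (h₁ : p i < x) (h₂ : x < p (i + 1)) :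
    IsSubdivision (m + 1) (insertPoint p i x) := by
  refine ⟨fun j hj => ?_, ?_⟩
  · rcases lt_trichotomy j i with h | rfl | h
    · rw [insertPoint_of_le h.le, insertPoint_of_le h]
      exact hp.1 j (by lia)
    · rwa [insertPoint_of_le le_rfl, insertPoint_self]
    · obtain ⟨j, rfl⟩ : ∃ k, j = k + 1 := ⟨j - 1, by lia⟩
      rcases (Nat.lt_succ_iff.1 h).eq_or_lt with rfl | h
      · rwa [insertPoint_self, insertPoint_succ_of_lt i.lt_succ_self]
      · rw [insertPoint_succ_of_lt h, insertPoint_succ_of_lt (by lia)]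
        exact hp.1 j (by lia)
  · rw [insertPoint_succ_of_lt (by lia), insertPoint_of_le i.zero_le, hp.2]

namespace Piecewise

variable {m : ℕ} {R S : (σ → Set ℝ) → (ℕ → ℝ) → Prop}

theorem congr (hR : Piecewise m R) (h : ∀ V p, IsSubdivision m p → (R V p ↔ S V p)) :
    Piecewise m S := by
  obtain ⟨L, hL, hR⟩ := hR
  exact ⟨L, hL, fun V p hp => (h V p hp).symm.trans (hR V p hp)⟩

theorem conj {M : ℕ → (σ → Set ℝ) → ℝ → ℝ → Prop} (hM : ∀ j, Decomp (M j)) :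
    Piecewise m (fun V p => ∀ j ≤ m, M j V (p j) (p (j + 1))) :=
  ⟨[M], by simpa using hM, fun V p _ => by simp⟩

theorem consecutive {M : (σ → Set ℝ) → ℝ → ℝ → Prop} (hM : Decomp M) {i : ℕ} (hi : i ≤ m) :
    Piecewise m (fun V p => M V (p i) (p (i + 1))) := by
  refine (conj (M := fun j => if j = i then M else fun _ _ _ => True) fun j => ?_).congr
    fun V p _ => ⟨fun h => by simpa using h i hi, fun h j _ => ?_⟩
  · split_ifs
    exacts [hM, Decomp.true]
  · split_ifs with hj
    exacts [hj ▸ h, trivial]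

theorem const (c : Prop) : Piecewise m (fun (_ : σ → Set ℝ) _ => c) := by
  by_cases hc : c
  · exact (conj fun _ => Decomp.true).congr fun V p _ => by simp [hc]
  · exact ⟨[], by simp, fun V p _ => by simp [hc]⟩

theorem or (hR : Piecewise m R) (hS : Piecewise m S) : Piecewise m (fun V p => R V p ∨ S V p) := by
  obtain ⟨L, hL, hR⟩ := hR
  obtain ⟨K, hK, hS⟩ := hS
  refine ⟨L ++ K, fun M hM => (List.mem_append.1 hM).elim (hL M) (hK M), fun V p hp => ?_⟩
  simp only [hR V p hp, hS V p hp, List.mem_append, or_and_right, exists_or]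

theorem exists_mem {ι : Type*} (L : List ι) {f : ι → (σ → Set ℝ) → (ℕ → ℝ) → Prop}
    (h : ∀ i ∈ L, Piecewise m (f i)) : Piecewise m (fun V p => ∃ i ∈ L, f i V p) := by
  induction L with
  | nil => exact (const False).congr fun V p _ => by simp
  | cons i L ih =>
    exact ((h i (by simp)).or (ih fun j hj => h j (by simp [hj]))).congr fun V p _ => by simp

theorem and (hR : Piecewise m R) (hS : Piecewise m S) :
    Piecewise m (fun V p => R V p ∧ S V p) := by
  obtain ⟨L, hL, hR⟩ := hR
  obtain ⟨K, hK, hS⟩ := hS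
  refine (exists_mem L fun M hM => exists_mem K fun N hN =>
    conj (M := fun j V a b => M j V a b ∧ N j V a b)
      fun j => (hL M hM j).and (hK N hN j)).congr fun V p hp => ?_
  rw [hR V p hp, hS V p hp]
  constructor
  · rintro ⟨M, hM, N, hN, h⟩
    exact ⟨⟨M, hM, fun j hj => (h j hj).1⟩, N, hN, fun j hj => (h j hj).2⟩
  · rintro ⟨⟨M, hM, h₁⟩, N, hN, h₂⟩
    exact ⟨M, hM, N, hN, fun j hj => ⟨h₁ j hj, h₂ j hj⟩⟩

theorem forall_mem {ι : Type*} (L : List ι) {f : ι → (σ → Set ℝ) → (ℕ → ℝ) → Prop}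
    (h : ∀ i ∈ L, Piecewise m (f i)) : Piecewise m (fun V p => ∀ i ∈ L, f i V p) := by
  induction L with
  | nil => exact (const True).congr fun V p _ => by simp
  | cons i L ih =>
    exact ((h i (by simp)).and (ih fun j hj => h j (by simp [hj]))).congr fun V p _ => by simp

theorem not (hR : Piecewise m R) : Piecewise m (fun V p => ¬ R V p) := by
  obtain ⟨L, hL, hR⟩ := hR
  refine (forall_mem L fun M hM => exists_mem (List.range (m + 1)) fun j hj =>
    consecutive (hL M hM j).not (Nat.lt_succ_iff.1 (List.mem_range.1 hj))).congr fun V p hp => ?_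
  rw [hR V p hp]
  push Not
  refine forall₂_congr fun M _ => exists_congr fun j => ?_
  rw [List.mem_range, Nat.lt_succ_iff]

/-- Elimination of a quantifier over the points between two consecutive points of a
subdivision. -/
theorem exists_insertPoint (hR : Piecewise (m + 1) R) {i : ℕ} (hi : i ≤ m) :
    Piecewise m (fun V p => ∃ x, p i < x ∧ x < p (i + 1) ∧ R V (insertPoint p i x)) := by
  obtain ⟨L, hL, hR⟩ := hR
  refine (exists_mem L fun M hM => conj (M := fun j => if j < i then M j else if j = i then
    fun V a b => ∃ x, a < x ∧ x < b ∧ M i V a x ∧ M (i + 1) V x b else M (j + 1))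
    fun j => ?_).congr fun V p hp => ?_
  · split_ifs
    exacts [hL M hM j, (hL M hM i).chop (hL M hM (i + 1)), hL M hM (j + 1)]
  · constructor
    · rintro ⟨M, hM, h⟩
      have hmid := h i hi
      simp only [lt_irrefl, if_false, if_true] at hmid
      obtain ⟨x, h₁, h₂, h₃, h₄⟩ := hmid
      refine ⟨x, h₁, h₂, (hR V _ (hp.insertPoint hi h₁ h₂)).2 ⟨M, hM, fun j hj => ?_⟩⟩
      rcases lt_trichotomy j i with hlt | rfl | hlt
      · have := h j (by lia)
        rw [if_pos hlt] at this
        rwa [insertPoint_of_le hlt.le, insertPoint_of_le hlt]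
      · rwa [insertPoint_of_le le_rfl, insertPoint_self]
      · obtain ⟨j, rfl⟩ : ∃ k, j = k + 1 := ⟨j - 1, by lia⟩
        rcases (Nat.lt_succ_iff.1 hlt).eq_or_lt with rfl | hlt
        · rwa [insertPoint_self, insertPoint_succ_of_lt i.lt_succ_self]
        · have := h j (by lia)
          rw [if_neg (by lia), if_neg (by lia)] at this
          rwa [insertPoint_succ_of_lt hlt, insertPoint_succ_of_lt (by lia)]
    · rintro ⟨x, h₁, h₂, h⟩
      obtain ⟨M, hM, h⟩ := (hR V _ (hp.insertPoint hi h₁ h₂)).1 h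
      refine ⟨M, hM, fun j hj => ?_⟩
      rcases lt_trichotomy j i with hlt | rfl | hlt
      · have := h j (by lia)
        rw [insertPoint_of_le hlt.le, insertPoint_of_le hlt] at this
        rwa [if_pos hlt]
      · have h₃ := h j (by lia)
        have h₄ := h (j + 1) (by lia)
        rw [insertPoint_of_le le_rfl, insertPoint_self] at h₃
        rw [insertPoint_self, insertPoint_succ_of_lt j.lt_succ_self] at h₄
        simp only [lt_irrefl, if_false, if_true]
        exact ⟨x, h₁, h₂, h₃, h₄⟩
      · have := h (j + 1) (by lia)
        rw [insertPoint_succ_of_lt hlt, insertPoint_succ_of_lt (by lia)] at this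
        rwa [if_neg (by lia), if_neg (by lia)]

end Piecewise

/-! ### Bounded formulas over a subdivision -/

/-- The real number named by `(i, k)`: the `i`-th point of the subdivision, shifted by the
integer `k`. -/
def shifted (p : ℕ → ℝ) (e : ℕ × ℤ) : ℝ := p e.1 + e.2

theorem IsSubdivision.shifted_lt_iff {m : ℕ} {p : ℕ → ℝ} (hp : IsSubdivision m p) {e e' : ℕ × ℤ}
    (he : e.1 ≤ m) (he' : e'.1 ≤ m) :
    shifted p e < shifted p e' ↔ e.2 < e'.2 ∨ e.2 = e'.2 ∧ e.1 < e'.1 := by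
  have key : ∀ {e e' : ℕ × ℤ}, e.1 ≤ m → e'.1 ≤ m →
      (e.2 < e'.2 ∨ e.2 = e'.2 ∧ e.1 < e'.1) → shifted p e < shifted p e' := by
    rintro ⟨i, k⟩ ⟨i', k'⟩ he he' (h | ⟨rfl, h⟩)
    · have h₁ : (k : ℝ) + 1 ≤ k' := by exact_mod_cast h
      have h₂ := hp.lt_add_one he
      have h₃ := hp.zero_le he'
      simp only [shifted] at *
      linarith
    · have := hp.lt h (he'.trans m.le_succ)
      simp only [shifted] at *
      linarith
  refine ⟨fun h => ?_, key he he'⟩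
  by_contra hn
  rcases eq_or_ne e e' with rfl | hne
  · exact lt_irrefl _ h
  · refine lt_asymm h (key he' he ?_)
    have : e.2 = e'.2 → e.1 ≠ e'.1 := fun h₂ h₁ => hne (Prod.ext h₁ h₂)
    lia

theorem IsSubdivision.shifted_inj {m : ℕ} {p : ℕ → ℝ} (hp : IsSubdivision m p) {e e' : ℕ × ℤ}
    (he : e.1 ≤ m) (he' : e'.1 ≤ m) : shifted p e = shifted p e' ↔ e = e' := by
  refine ⟨fun h => ?_, fun h => h ▸ rfl⟩
  have h₁ := (hp.shifted_lt_iff he he').not.1 h.not_lt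
  have h₂ := (hp.shifted_lt_iff he' he).not.1 h.not_gt
  exact Prod.ext (by lia) (by lia)

/-- The value of a term when the free variable has value `z` and the bound variables have values
`xs`. -/
def termValue (V : σ → Set ℝ) {n : ℕ} (t : (foLang σ).Term (Unit ⊕ Fin n)) (z : ℝ)
    (xs : Fin n → ℝ) : ℝ :=
  letI := realLine V
  t.realize (Sum.elim (fun _ => z) xs)

/-- A formula is true when the free variable has value `z` and the bound variables have values
`xs`. -/
def FORealize (V : σ → Set ℝ) {n : ℕ} (φ : (foLang σ).BoundedFormula Unit n) (z : ℝ)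
    (xs : Fin n → ℝ) : Prop :=
  letI := realLine V
  φ.Realize (fun _ => z) xs

theorem foRealize_inf (V : σ → Set ℝ) {n : ℕ} (φ χ : (foLang σ).BoundedFormula Unit n) (z : ℝ)
    (xs : Fin n → ℝ) : FORealize V (φ ⊓ χ) z xs ↔ FORealize V φ z xs ∧ FORealize V χ z xs :=
  letI := realLine V
  FirstOrder.Language.BoundedFormula.realize_inf

theorem foRealize_all (V : σ → Set ℝ) {n : ℕ} (φ : (foLang σ).BoundedFormula Unit (n + 1)) (z : ℝ)
    (xs : Fin n → ℝ) : FORealize V φ.all z xs ↔ ∀ y, FORealize V φ z (Fin.snoc xs y) :=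
  Iff.rfl

theorem foRealize_ex (V : σ → Set ℝ) {n : ℕ} (φ : (foLang σ).BoundedFormula Unit (n + 1)) (z : ℝ)
    (xs : Fin n → ℝ) : FORealize V φ.ex z xs ↔ ∃ y, FORealize V φ z (Fin.snoc xs y) :=
  letI := realLine V
  FirstOrder.Language.BoundedFormula.realize_ex

theorem foRealize_ltFormula (V : σ → Set ℝ) {n : ℕ} (s t : (foLang σ).Term (Unit ⊕ Fin n)) (z : ℝ)
    (xs : Fin n → ℝ) : FORealize V (ltFormula s t) z xs ↔ termValue V s z xs < termValue V t z xs :=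
  Iff.rfl

theorem termValue_addNat (V : σ → Set ℝ) {n : ℕ} (t : (foLang σ).Term (Unit ⊕ Fin n)) (z : ℝ)
    (xs : Fin n → ℝ) (k : ℕ) : termValue V (addNat t k) z xs = termValue V t z xs + k := by
  induction k with
  | zero => simp [addNat]
  | succ k ih =>
    change termValue V (addNat t k) z xs + (1 : ℝ) = _
    rw [ih]
    push_cast
    ring

theorem foRealize_window (V : σ → Set ℝ) {N n : ℕ} (z : ℝ) (xs : Fin n → ℝ) (y : ℝ) :
    FORealize V (window σ N n) z (Fin.snoc xs y) ↔ z < y + N ∧ y < z + N := by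
  rw [window, foRealize_inf, foRealize_ltFormula, foRealize_ltFormula, termValue_addNat,
    termValue_addNat]
  simp [termValue]

theorem exists_termValue_eq_shifted {n m : ℕ} (f : Fin n → ℕ × ℤ) (hf : ∀ i, (f i).1 ≤ m)
    (t : (foLang σ).Term (Unit ⊕ Fin n)) : ∃ e : ℕ × ℤ, e.1 ≤ m ∧ ∀ (V : σ → Set ℝ) (p : ℕ → ℝ),
      termValue V t (p 0) (fun i => shifted p (f i)) = shifted p e := by
  induction t with
  | var x =>
    rcases x with _ | i
    · exact ⟨(0, 0), m.zero_le, fun V p => by simp [shifted, termValue]⟩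
    · exact ⟨f i, hf i, fun V p => rfl⟩
  | func g ts ih =>
    cases g
    obtain ⟨e, he, h⟩ := ih 0
    refine ⟨(e.1, e.2 + 1), he, fun V p => ?_⟩
    change termValue V (ts 0) (p 0) (fun i => shifted p (f i)) + (1 : ℝ) = _
    rw [h V p]
    simp only [shifted]
    push_cast
    ring

theorem piecewise_ltFormula {n m : ℕ} (f : Fin n → ℕ × ℤ) (hf : ∀ i, (f i).1 ≤ m)
    (s t : (foLang σ).Term (Unit ⊕ Fin n)) : Piecewise m fun (V : σ → Set ℝ) p =>
      FORealize V (ltFormula s t) (p 0) fun i => shifted p (f i) := by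
  obtain ⟨e, he, h⟩ := exists_termValue_eq_shifted f hf s
  obtain ⟨e', he', h'⟩ := exists_termValue_eq_shifted f hf t
  refine (Piecewise.const (e.2 < e'.2 ∨ e.2 = e'.2 ∧ e.1 < e'.1)).congr fun V p hp => ?_
  rw [foRealize_ltFormula, h V p, h' V p, hp.shifted_lt_iff he he']

theorem piecewise_window {N n m : ℕ} (f : Fin (n + 1) → ℕ × ℤ) (hf : ∀ i, (f i).1 ≤ m) :
    Piecewise m fun (V : σ → Set ℝ) p =>
      FORealize V (window σ N n) (p 0) fun i => shifted p (f i) :=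
  ((piecewise_ltFormula f hf _ _).and (piecewise_ltFormula f hf _ _)).congr
    fun V _ _ => (foRealize_inf V _ _ _ _).symm

/-- Elimination of a quantifier that ranges over a bounded window around `p 0`: each point `y` of
the window is of the form `x + k`, where `x ∈ [p 0, p 0 + 1)` and there are finitely many values for
the integer `k`; the point `x` is a point of the subdivision or lies between two of them. -/
theorem Piecewise.exists_window {n m : ℕ} {χ : (σ → Set ℝ) → ℝ → (Fin (n + 1) → ℝ) → Prop}
    (hχ : ∀ (m : ℕ) (f : Fin (n + 1) → ℕ × ℤ), (∀ i, (f i).1 ≤ m) →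
      Piecewise m fun V p => χ V (p 0) fun i => shifted p (f i))
    (N : ℕ) (hN : ∀ V z (xs : Fin n → ℝ) y, χ V z (Fin.snoc xs y) → z < y + N ∧ y < z + N)
    (f : Fin n → ℕ × ℤ) (hf : ∀ i, (f i).1 ≤ m) :
    Piecewise m fun V p => ∃ y, χ V (p 0) (Fin.snoc (fun i => shifted p (f i)) y) := by
  set up : ℕ → ℕ × ℤ → ℕ × ℤ := fun i e => (if e.1 ≤ i then e.1 else e.1 + 1, e.2) with hup
  have hat : ∀ k : ℤ, ∀ i ≤ m, Piecewise m fun V p =>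
      χ V (p 0) (Fin.snoc (fun i => shifted p (f i)) (p i + k)) := by
    intro k i hi
    refine (hχ m (Fin.snoc f (i, k) : Fin (n + 1) → ℕ × ℤ) fun j => ?_).congr fun V p _ => ?_
    · refine Fin.lastCases ?_ (fun j => ?_) j
      · simpa using hi
      · simpa using hf j
    · refine iff_of_eq (congrArg (χ V (p 0)) ?_)
      refine funext fun j => Fin.lastCases ?_ (fun j => ?_) j
      · simp [shifted]
      · simp
  have hbetween : ∀ k : ℤ, ∀ i ≤ m, Piecewise m fun V p => ∃ x, p i < x ∧ x < p (i + 1) ∧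
      χ V (p 0) (Fin.snoc (fun i => shifted p (f i)) (x + k)) := by
    intro k i hi
    refine ((hχ (m + 1) (Fin.snoc (fun j => up i (f j)) (i + 1, k) : Fin (n + 1) → ℕ × ℤ)
      fun j => ?_).exists_insertPoint hi).congr fun V p _ => ?_
    · refine Fin.lastCases ?_ (fun j => ?_) j
      · simpa using hi
      · have := hf j
        simp only [hup, Fin.snoc_castSucc]
        split_ifs <;> lia
    · refine exists_congr fun x => and_congr_right fun _ => and_congr_right fun _ => ?_
      rw [insertPoint_of_le i.zero_le]
      refine iff_of_eq (congrArg (χ V (p 0)) ?_)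
      refine funext fun j => Fin.lastCases ?_ (fun j => ?_) j
      · simp [shifted]
      · simp only [hup, Fin.snoc_castSucc, shifted]
        split_ifs with h
        · rw [insertPoint_of_le h]
        · rw [insertPoint_succ_of_lt (by lia)]
  refine (Piecewise.exists_mem (Finset.Icc (-N : ℤ) N).toList fun k _ =>
    Piecewise.exists_mem (List.range (m + 1)) fun i hi =>
      (hat k i (Nat.lt_succ_iff.1 (List.mem_range.1 hi))).or
        (hbetween k i (Nat.lt_succ_iff.1 (List.mem_range.1 hi)))).congr fun V p hp => ?_
  constructor
  · rintro ⟨k, -, i, -, h | ⟨x, -, -, h⟩⟩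
    exacts [⟨_, h⟩, ⟨_, h⟩]
  · rintro ⟨y, h⟩
    obtain ⟨h₁, h₂⟩ := hN V _ _ y h
    set k := ⌊y - p 0⌋ with hk
    have hk₁ : (k : ℝ) ≤ y - p 0 := Int.floor_le _
    have hk₂ : y - p 0 < k + 1 := Int.lt_floor_add_one _
    obtain ⟨i, hi, hle, hlt⟩ := hp.exists_mem_Ico (x := y - k) (by linarith) (by linarith)
    have hmem : -(N : ℤ) ≤ k ∧ k ≤ N := by
      constructor
      · have : (-(N : ℤ) : ℝ) < k + 1 := by push_cast; linarith
        have : -(N : ℤ) < k + 1 := by exact_mod_cast this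
        lia
      · have : (k : ℝ) < (N : ℤ) := by push_cast; linarith
        have : k < (N : ℤ) := by exact_mod_cast this
        lia
    refine ⟨k, by simpa using hmem, i, List.mem_range.2 (Nat.lt_succ_of_le hi), ?_⟩
    rcases hle.eq_or_lt with heq | hlt'
    · left
      rwa [heq, sub_add_cancel]
    · exact .inr ⟨y - k, hlt', hlt, by rwa [sub_add_cancel]⟩

/-- Every variable of a bounded formula may be taken to be a point of a subdivision of `[z, z + 1]`
shifted by an integer, where `z` is the free variable. On such values equality and order do not
depend on the subdivision, the predicates are definable properties of single points of it, and a
quantifier amounts to the insertion of at most one more point. -/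
theorem IsNBounded.piecewise {N n : ℕ} {φ : (foLang σ).BoundedFormula Unit n}
    (hφ : IsNBounded N φ) : ∀ (m : ℕ) (f : Fin n → ℕ × ℤ), (∀ i, (f i).1 ≤ m) →
      Piecewise m fun V p => FORealize V φ (p 0) fun i => shifted p (f i) := by
  induction hφ with
  | falsum => exact fun m f _ => Piecewise.const False
  | equal s t =>
    intro m f hf
    obtain ⟨e, he, h⟩ := exists_termValue_eq_shifted f hf s
    obtain ⟨e', he', h'⟩ := exists_termValue_eq_shifted f hf t
    refine (Piecewise.const (e = e')).congr fun V p hp => ?_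
    change _ ↔ termValue V s _ _ = termValue V t _ _
    rw [h V p, h' V p, hp.shifted_inj he he']
  | rel R ts =>
    intro m f hf
    cases R with
    | pred P =>
      obtain ⟨e, he, h⟩ := exists_termValue_eq_shifted f hf (ts 0)
      refine (Piecewise.consecutive (Decomp.left ((udef_pred P).shift e.2)) he).congr
        fun V p _ => ?_
      change shifted p e ∈ V P ↔ termValue V (ts 0) (p 0) (fun i => shifted p (f i)) ∈ V P
      rw [h V p]
    | lt =>
      exact (piecewise_ltFormula f hf (ts 0) (ts 1)).congr fun V p _ => Iff.rfl
  | imp _ _ ih₁ ih₂ =>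
    intro m f hf
    exact ((ih₁ m f hf).not.or (ih₂ m f hf)).congr fun V p _ => imp_iff_not_or.symm
  | @all n φ _ ih =>
    intro m f hf
    refine (Piecewise.exists_window
      (χ := fun V z xs => FORealize V (window σ N n) z xs ∧ ¬ FORealize V φ z xs)
      (fun m f hf => (piecewise_window f hf).and (ih m f hf).not) N
      (fun V z xs y h => (foRealize_window V z xs y).1 h.1) f hf).not.congr fun V p _ => ?_
    rw [foRealize_all, not_exists]
    exact forall_congr' fun y => by rw [not_and, not_not]; rfl
  | @ex n φ _ ih =>
    intro m f hf
    refine (Piecewise.exists_window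
      (χ := fun V z xs => FORealize V (window σ N n) z xs ∧ FORealize V φ z xs)
      (fun m f hf => (piecewise_window f hf).and (ih m f hf)) N
      (fun V z xs y h => (foRealize_window V z xs y).1 h.1) f hf).congr fun V p _ => ?_
    rw [foRealize_ex]
    exact exists_congr fun y => (foRealize_inf V _ _ _ _).symm

/-- A bounded formula expresses a decomposable relation between `z` and `z + 1`. -/
theorem IsBounded.exists_decomp {ψ : (foLang σ).Formula Unit} (hψ : IsBounded ψ) :
    ∃ M, Decomp M ∧ ∀ V z, FOHolds V ψ z ↔ M V z (z + 1) := by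
  obtain ⟨N, hN⟩ := hψ
  obtain ⟨L, hL, h⟩ := hN.piecewise 0 Fin.elim0 fun i => i.elim0
  refine ⟨fun V a b => ∃ M ∈ L, M 0 V a b, Decomp.exists_mem L fun M hM => hL M hM 0,
    fun V z => ?_⟩
  -- the subdivision of `[z, z + 1]` without inner points
  have hp : IsSubdivision 0 (fun j => z + j) := ⟨fun j _ => by simp, by simp⟩
  have h := h V _ hp
  simp only [Nat.le_zero, forall_eq, Nat.cast_zero, add_zero, zero_add, Nat.cast_one] at h
  refine Iff.trans ?_ h
  exact iff_of_eq (congrArg (FORealize V ψ z) (Subsingleton.elim _ _))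

end MetricLogic

theorem mainTheorem1 {σ : Type u} (ψ : (MetricLogic.foLang σ).Formula Unit)
    (hψ : MetricLogic.IsBounded ψ) :
    ∃ ψ' : MetricLogic.Q2MLO σ 1, ∀ (V : σ → Set ℝ) (z : ℝ),
      MetricLogic.FOHolds V ψ z ↔ MetricLogic.Q2MLO.Holds V ψ' z := by
  obtain ⟨M, hM, h⟩ := hψ.exists_decomp
  obtain ⟨ψ', hψ'⟩ := hM.udef
  exact ⟨ψ', fun V z => (h V z).trans (hψ' V z).symm⟩
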